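/- Let $(W,S)$ be a Coxeter system with length function $\ell$ and Bruhat order $\le$. For $I\subset S$ let $W_I$ be the subgroup generated by $I$; call $I$ finitary if $W_I$ is finite, and then let $w_I$ be its longest element. Let $*$ be the Demazure product on $W$, i.e. the associative product determined by $x*1=x$ and, for $s\in S$, $x*s=xs$ if $\ell(xs)>\ell(x)$ and $x*s=x$ otherwise. An $(I,J)$-coset is an element of $W_I\backslash W/W_J$ (the sets $I,J$ being part of the data). A (singlestep) expression is a sequence $I_\bullet=[I_0,\dots,I_d]$ ($d\ge 0$) of finitary subsets of $S$ in which each $I_k$ with $k\geq 1$ arises from $I_{k-1}$ by adding or removing exactly one element. For an $(I,J)$-coset $p$ ($I,J$ finitary) with maximal element $\overline p$, we write $I_\bullet\leftrightharpoons p$ and say that $I_\bullet$ is an expression of $p$ if $I_0=I$, $I_d=J$ and $\overline p=w_{I_0}*w_{I_1}*\cdots*w_{I_d}$. Let $[[I_0\subset K_1\supset I'_1\subset K_2\supset\cdots\subset K_m\supset I'_m=I_d]]$ be the sequence of local maxima and minima of $I_\bullet$ (with $K_1=I_0$ if $I_\bullet$ begins with a descent and $K_m=I'_m$ if it ends with an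 ascent; $m=1$ and $K_1=I'_1=I_0$ if $d=0$). An expression $I_\bullet\leftrightharpoons p$ is reduced if $$\overline p=(w_{K_1}w_{I'_1}^{-1})(w_{K_2}w_{I'_2}^{-1})\cdots(w_{K_m}w_{I'_m}^{-1})\,w_{I'_m}$$ and the lengths of these $m+1$ factors add up to $\ell(\overline p)$. A path subordinate to $I_\bullet$ is a sequence $p_\bullet=[p_0,\dots,p_d]$ in which $p_k$ is an $(I_0,I_k)$-coset, $p_0$ contains the identity, $p_{k+1}\supset p_k$ if $I_k\subset I_{k+1}$, and $p_{k+1}\subset p_k$ if $I_k\supset I_{k+1}$. Its terminus is $p_d$. Theorem. Let $I,J\subset S$ be finitary. Every $(I,J)$-coset $r$ has a greatest element $\overline r$ and a least element $\underline r$ in the Bruhat order. For $(I,J)$-cosets $p,q$ the following are equivalent: (1) $\overline p\le\overline q$; (2) $\underline p\le\underline q$ (that is, $p\le q$ in the Bruhat order on double cosets); (3) there are a reduced expression $I_\bullet\leftrightharpoons q$ and a path subordinate to $I_\bullet$ with terminus $p$; (4) for every expression $I_\bullet\leftrightharpoons q$, reduced or not, there is a path subordinate to $I_\bullet$ with terminus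 $p$. -/

import Mathlib

namespace CoxeterSystem

variable {B : Type*} {M : CoxeterMatrix B} {W : Type*} [Group W]

/-- The standard parabolic subgroup `W_I`. -/
def parabolic (cs : CoxeterSystem M W) (I : Set B) : Subgroup W :=
  Subgroup.closure (cs.simple '' I)

/-- `I` is finitary if `W_I` is finite. -/
def IsFinitary (cs : CoxeterSystem M W) (I : Set B) : Prop :=
  (cs.parabolic I : Set W).Finite

/-- The Bruhat order on `W`: the reflexive and transitive closure of the relation
`u → u * t` for `t` a reflection with `ℓ u < ℓ (u * t)`. -/
def BruhatLE (cs : CoxeterSystem M W) : W → W → Prop :=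
  Relation.ReflTransGen
    (fun u v => ∃ t, cs.IsReflection t ∧ v = u * t ∧ cs.length u < cs.length v)

/-- `w` is a longest element of `W_I`. -/
def IsLongestIn (cs : CoxeterSystem M W) (I : Set B) (w : W) : Prop :=
  w ∈ cs.parabolic I ∧ ∀ v ∈ cs.parabolic I, cs.length v ≤ cs.length w

theorem exists_isLongestIn (cs : CoxeterSystem M W) {I : Set B} (hI : cs.IsFinitary I) :
    ∃ w, cs.IsLongestIn I w := by
  obtain ⟨w, hw, h⟩ :=
    Set.exists_max_image (cs.parabolic I : Set W) cs.length hI ⟨1, (cs.parabolic I).one_mem⟩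
  exact ⟨w, hw, h⟩

/-- The longest element `w_I` of `W_I`, for `I` finitary. -/
noncomputable def longest (cs : CoxeterSystem M W) (I : Set B) : W :=
  Classical.epsilon (cs.IsLongestIn I)

theorem longest_spec (cs : CoxeterSystem M W) {I : Set B} (hI : cs.IsFinitary I) :
    cs.IsLongestIn I (cs.longest I) :=
  Classical.epsilon_spec (cs.exists_isLongestIn hI)

/-- Right multiplication by a simple reflection in the Coxeter monoid (Demazure product):
`w * s = ws` if `ℓ (ws) > ℓ w`, and `w * s = w` otherwise. -/
noncomputable def starSimple (cs : CoxeterSystem M W) (w : W) (i : B) : W :=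
  if cs.length w < cs.length (w * cs.simple i) then w * cs.simple i else w

/-- The `*`-product (Demazure product) on `W`: `x * y = x * s₁ * ⋯ * sₖ` for a reduced word
`s₁ ⋯ sₖ` of `y`. The result does not depend on the reduced word; one is chosen. -/
noncomputable def star (cs : CoxeterSystem M W) (x y : W) : W :=
  (cs.exists_isReduced y).choose.foldl cs.starSimple x

/-- `p` is an `(I, J)`-coset, i.e. an element of `W_I \ W / W_J`. The sets `I` and `J` are
always carried along, so that the same subset of `W` may be a coset for several pairs. -/
def IsCoset (cs : CoxeterSystem M W) (I J : Set B) (p : Set W) : Prop :=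
  ∃ w : W, p = DoubleCoset.doubleCoset w (cs.parabolic I : Set W) (cs.parabolic J : Set W)

/-- `x` is the maximal (i.e. greatest) element of `p` in the Bruhat order. -/
def IsMaxIn (cs : CoxeterSystem M W) (p : Set W) (x : W) : Prop :=
  x ∈ p ∧ ∀ y ∈ p, cs.BruhatLE y x

/-- `x` is the minimal (i.e. least) element of `p` in the Bruhat order. -/
def IsMinIn (cs : CoxeterSystem M W) (p : Set W) (x : W) : Prop :=
  x ∈ p ∧ ∀ y ∈ p, cs.BruhatLE x y

/-- The maximal element of a double coset in the Bruhat order. -/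
noncomputable def maxRep (cs : CoxeterSystem M W) (p : Set W) : W :=
  Classical.epsilon (cs.IsMaxIn p)

/-- The minimal element of a double coset in the Bruhat order. -/
noncomputable def minRep (cs : CoxeterSystem M W) (p : Set W) : W :=
  Classical.epsilon (cs.IsMinIn p)

/-- A singlestep expression `[I₀, …, I_d]`: a sequence of finitary subsets in which each term
arises from the previous one by adding or by removing one element. -/
structure SinglestepExpr (cs : CoxeterSystem M W) where
  width : ℕ
  set : Fin (width + 1) → Set B
  finitary : ∀ k, cs.IsFinitary (set k)
  step : ∀ k : Fin width, ∃ s : B,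
    (s ∉ set k.castSucc ∧ set k.succ = set k.castSucc ∪ {s}) ∨
    (s ∈ set k.castSucc ∧ set k.succ = set k.castSucc \ {s})

open Classical in
/-- Auxiliary recursion for the local maxima and minima of a sequence of subsets. Here `K` is the
most recent local maximum (so far) and `C` is the current set; `K = C` while the sequence is
ascending, and `C ⊂ K` while it is descending. -/
noncomputable def peaksAux (K C : Set B) : List (Set B) → List (Set B × Set B)
  | [] => [(K, C)]
  | D :: l =>
    if D ⊆ C then peaksAux K D l
    else if K = C then peaksAux D D l
    else (K, C) :: peaksAux D D l

namespace SinglestepExpr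

variable {cs : CoxeterSystem M W}

/-- The first set `I₀`. -/
def first (E : cs.SinglestepExpr) : Set B := E.set 0

/-- The last set `I_d`. -/
def last (E : cs.SinglestepExpr) : Set B := E.set (Fin.last E.width)

/-- The multistep expression `[[I₀ ⊂ K₁ ⊃ I₁ ⊂ K₂ ⊃ ⋯ ⊂ K_m ⊃ I_m]]` of the local maxima and
minima of `E`, as the list of pairs `(K₁, I₁), …, (K_m, I_m)`. By convention `K₁ = I₀` if `E`
begins with a descent, and `I_m = K_m` if it ends with an ascent. -/
noncomputable def multistep (E : cs.SinglestepExpr) : List (Set B × Set B) :=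
  peaksAux E.first E.first (List.ofFn fun k : Fin E.width => E.set k.succ)

/-- `E ⇌ p`: the expression `E` expresses the `(I, J)`-coset `p`, that is, `I₀ = I`, `I_d = J`
and the maximal element of `p` is `w_{I₀} * w_{I₁} * ⋯ * w_{I_d}`. -/
def Expresses (E : cs.SinglestepExpr) (I J : Set B) (p : Set W) : Prop :=
  E.first = I ∧ E.last = J ∧ cs.IsCoset I J p ∧
    cs.maxRep p = (List.ofFn fun k => cs.longest (E.set k)).foldl cs.star 1

/-- The factors `w_{K₁} w_{I₁}⁻¹, …, w_{K_m} w_{I_m}⁻¹, w_{I_m}`. -/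
noncomputable def factors (E : cs.SinglestepExpr) : List W :=
  E.multistep.map (fun KI => cs.longest KI.1 * (cs.longest KI.2)⁻¹) ++ [cs.longest E.last]

/-- `E` is a reduced expression of the `(I, J)`-coset `p`: it expresses `p`, and the maximal
element of `p` is the reduced product (lengths add up)
`(w_{K₁} w_{I₁}⁻¹) . ⋯ . (w_{K_m} w_{I_m}⁻¹) . w_{I_m}`. -/
def ReducedExpresses (E : cs.SinglestepExpr) (I J : Set B) (p : Set W) : Prop :=
  E.Expresses I J p ∧ cs.maxRep p = E.factors.prod ∧
    cs.length E.factors.prod = (E.factors.map cs.length).sum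

/-- A path `[p₀, …, p_d]` subordinate to `E = [I₀, …, I_d]`. -/
structure IsSubordinatePath (E : cs.SinglestepExpr) (p : Fin (E.width + 1) → Set W) : Prop where
  isCoset : ∀ k, cs.IsCoset E.first (E.set k) (p k)
  one_mem : (1 : W) ∈ p 0
  up : ∀ k : Fin E.width, E.set k.castSucc ⊆ E.set k.succ → p k.castSucc ⊆ p k.succ
  down : ∀ k : Fin E.width, E.set k.succ ⊆ E.set k.castSucc → p k.succ ⊆ p k.castSucc

/-- `p` is the terminus of a path subordinate to `E`. -/
def IsTerminus (E : cs.SinglestepExpr) (p : Set W) : Prop :=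
  ∃ path : Fin (E.width + 1) → Set W, E.IsSubordinatePath path ∧ path (Fin.last E.width) = p

end SinglestepExpr

end CoxeterSystem

/-! The proof replaces elements of `W` by their lower order ideals in the Bruhat order. By the
lifting property, Demazure multiplication of x by a simple s multiplies the ideal of x by the set
{1, s}. So the ideal of a Demazure product is the product of the ideals (`bruhatIic_star`). The
ideal of w_I is W_I, hence any expression [I_0, ..., I_d] of q, reduced or not, makes the ideal of
the greatest element of q equal to W_{I_0} ⋯ W_{I_d}.

On the other side, the termini of subordinate paths are exactly the cosets contained in this product
(`exists_path_iff_subset_parabolicProd`). The ideal of the greatest element of q is stable under W_I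
on the left and W_J on the right, so it contains all of p as soon as it contains one element of p.
Therefore p is a terminus of a given expression of q if and only if condition (1) holds
(`Expresses.isTerminus_iff`). This settles (1) → (4) and (3) → (1), and the same stability compares
greatest with least elements for (1) ↔ (2).

For (4) → (3) a reduced expression of q must exist (`exists_isReducedList`). Write the greatest
element as w_I v with v minimal in W_I v, and let y = d w_J be the greatest element of v W_J. Then y
= w_K v for some K ⊆ I, so w_I v = (w_I w_K⁻¹) y with lengths adding. Descend from I to K, add a
left descent s ∉ K of y, and continue with y. If there is no such s, the greatest element is w_I
itself and J ⊆ I. -/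

namespace CoxeterSystem

open scoped Pointwise

/-! ### Strong exchange through the inversion cocycle -/

section Inversion

variable {B : Type*} {M : CoxeterMatrix B} {W : Type*} [Group W] (cs : CoxeterSystem M W)

open Classical in
/-- The permutation `(t, ε) ↦ (sᵢ t sᵢ, ε + [t = sᵢ])` underlying the inversion cocycle. -/
noncomputable def inversionPerm (i : B) : Equiv.Perm (W × ZMod 2) :=
  Function.Involutive.toPerm
    (fun x => (cs.simple i * x.1 * cs.simple i, x.2 + if x.1 = cs.simple i then 1 else 0)) (by
      rintro ⟨t, e⟩
      have h : cs.simple i * t * cs.simple i = cs.simple i ↔ t = cs.simple i := by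
        constructor
        · intro h
          have := congrArg (fun x => cs.simple i * x * cs.simple i) h
          simpa [mul_assoc] using this
        · rintro rfl; simp
      refine Prod.ext ?_ ?_
      · simp [mul_assoc]
      · simp only [h]
        split_ifs
        · rw [add_assoc, CharTwo.add_self_eq_zero, add_zero]
        · simp)

open Classical in
theorem inversionPerm_apply (i : B) (x : W × ZMod 2) :
    cs.inversionPerm i x =
      (cs.simple i * x.1 * cs.simple i, x.2 + if x.1 = cs.simple i then 1 else 0) := rfl

-- Each factor tests the current conjugate of t against a simple reflection. With r = s_i s_j, the
-- identity r^k s_j r^k = s_j rewrites the 2n tests as t = s_j r^l for l < 2n.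
open Classical in
theorem inversionPerm_mul_pow_apply (i j : B) (n : ℕ) (t : W) (e : ZMod 2) :
    ((cs.inversionPerm i * cs.inversionPerm j) ^ n) (t, e) =
      ((cs.simple i * cs.simple j) ^ n * t * ((cs.simple i * cs.simple j) ^ n)⁻¹,
        e + ∑ l ∈ Finset.range (2 * n),
          if t = cs.simple j * (cs.simple i * cs.simple j) ^ l then 1 else 0) := by
  induction n with
  | zero => simp
  | succ n ih =>
    set r := cs.simple i * cs.simple j with hr
    have hjr : ∀ k : ℕ, r ^ k * cs.simple j * r ^ k = cs.simple j := by
      intro k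
      induction k with
      | zero => simp
      | succ k ihk =>
        calc r ^ (k + 1) * cs.simple j * r ^ (k + 1)
            = r ^ k * (r * cs.simple j * r) * r ^ k := by
              nth_rw 2 [pow_succ']
              simp only [pow_succ, mul_assoc]
          _ = r ^ k * cs.simple j * r ^ k := by
              congr 2
              simp [hr, mul_assoc]
          _ = _ := ihk
    have h1 : r ^ n * t * (r ^ n)⁻¹ = cs.simple j ↔ t = cs.simple j * r ^ (2 * n) := by
      rw [mul_inv_eq_iff_eq_mul]
      have e : r ^ n * (cs.simple j * r ^ (2 * n)) = cs.simple j * r ^ n := by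
        rw [two_mul, pow_add, ← mul_assoc, ← mul_assoc, hjr]
      rw [← e, mul_right_inj]
    have h2 : cs.simple j * (r ^ n * t * (r ^ n)⁻¹) * cs.simple j = cs.simple i ↔
        t = cs.simple j * r ^ (2 * n + 1) := by
      have : cs.simple j * (r ^ n * t * (r ^ n)⁻¹) * cs.simple j = cs.simple i ↔
          r ^ n * t * (r ^ n)⁻¹ = cs.simple j * r := by
        constructor
        · intro h
          have := congrArg (fun x => cs.simple j * x * cs.simple j) h
          simpa [mul_assoc, hr] using this
        · intro h
          rw [h]; simp [hr, mul_assoc]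
      rw [this, mul_inv_eq_iff_eq_mul]
      have e : r ^ n * (cs.simple j * r ^ (2 * n + 1)) = cs.simple j * r * r ^ n := by
        rw [show 2 * n + 1 = n + (1 + n) by ring, pow_add, ← mul_assoc, ← mul_assoc, hjr, pow_add,
          pow_one, ← mul_assoc]
      rw [← e, mul_right_inj]
    rw [pow_succ', Equiv.Perm.mul_apply, ih, Equiv.Perm.mul_apply, inversionPerm_apply,
      inversionPerm_apply]
    refine Prod.ext ?_ ?_
    · simp only [pow_succ', mul_inv_rev, hr, inv_simple, mul_assoc]
    · simp only [h1, h2]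
      rw [show 2 * (n + 1) = 2 * n + 1 + 1 by ring, Finset.sum_range_succ, Finset.sum_range_succ]
      ring

/-- Since r^m = 1 for m = `M i j`, the tests numbered l and l + m coincide, and the 2m contributions
cancel in pairs modulo 2. -/
theorem isLiftable_inversionPerm : M.IsLiftable cs.inversionPerm := by
  classical
  intro i j
  ext1 ⟨t, e⟩
  rw [inversionPerm_mul_pow_apply, two_mul, Finset.sum_range_add]
  simp only [pow_add, simple_mul_simple_pow, one_mul, mul_one, inv_one, Equiv.Perm.one_apply,
    CharTwo.add_self_eq_zero, add_zero]

/-- The action of `W` on `W × ZMod 2` extending `inversionPerm`. -/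
noncomputable def inversionAction : W →* Equiv.Perm (W × ZMod 2) :=
  cs.lift ⟨cs.inversionPerm, cs.isLiftable_inversionPerm⟩

theorem inversionAction_simple (i : B) : cs.inversionAction (cs.simple i) = cs.inversionPerm i :=
  cs.lift_apply_simple _ i

/-- The inversion cocycle: for a reflection `t` it is `1` if `ℓ (w * t) < ℓ w`, and `0` otherwise. -/
noncomputable def inversionCocycle (w t : W) : ZMod 2 := (cs.inversionAction w (t, 0)).2

theorem inversionAction_apply (w t : W) (e : ZMod 2) :
    cs.inversionAction w (t, e) = (w * t * w⁻¹, e + cs.inversionCocycle w t) := by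
  classical
  unfold inversionCocycle
  induction w using cs.simple_induction_left generalizing t e with
  | one => simp
  | mul_simple_left w i ih =>
    rw [map_mul, Equiv.Perm.mul_apply, ih, Equiv.Perm.mul_apply, ih t 0, inversionAction_simple,
      inversionPerm_apply, inversionPerm_apply]
    refine Prod.ext ?_ ?_
    · simp [mul_assoc]
    · simp [add_assoc]

theorem inversionCocycle_mul (u v t : W) :
    cs.inversionCocycle (u * v) t =
      cs.inversionCocycle v t + cs.inversionCocycle u (v * t * v⁻¹) := by
  rw [inversionCocycle, map_mul, Equiv.Perm.mul_apply, inversionAction_apply,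
    inversionAction_apply, zero_add]

open Classical in
theorem inversionCocycle_simple (i : B) (t : W) :
    cs.inversionCocycle (cs.simple i) t = if t = cs.simple i then 1 else 0 := by
  rw [inversionCocycle, inversionAction_simple, inversionPerm_apply, zero_add]

theorem inversionCocycle_one (t : W) : cs.inversionCocycle 1 t = 0 := by
  simp [inversionCocycle]

/-- For t = w s w⁻¹ the contributions of w and w⁻¹ cancel, because the cocycle of w w⁻¹ = 1
vanishes; the middle letter s contributes 1. -/
theorem inversionCocycle_self {t : W} (ht : cs.IsReflection t) : cs.inversionCocycle t t = 1 := by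
  classical
  obtain ⟨w, i, rfl⟩ := ht
  have h := cs.inversionCocycle_mul w w⁻¹ (w * cs.simple i * w⁻¹)
  rw [mul_inv_cancel, inversionCocycle_one] at h
  have e : w⁻¹ * (w * cs.simple i * w⁻¹) * w⁻¹⁻¹ = cs.simple i := by group
  rw [e] at h
  rw [inversionCocycle_mul, inversionCocycle_mul, e, inversionCocycle_simple, if_pos rfl]
  simp only [inv_simple, simple_mul_simple_self, one_mul]
  linear_combination -h

theorem mem_rightInvSeq_of_inversionCocycle_ne_zero (ω : List B) (t : W)
    (h : cs.inversionCocycle (cs.wordProd ω) t ≠ 0) : t ∈ cs.rightInvSeq ω := by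
  classical
  induction ω with
  | nil => simp [inversionCocycle_one] at h
  | cons i ω ih =>
    rw [wordProd_cons, inversionCocycle_mul, inversionCocycle_simple] at h
    rw [rightInvSeq, List.mem_cons]
    by_cases h' : cs.inversionCocycle (cs.wordProd ω) t = 0
    · left
      by_contra hne
      rw [h', zero_add, if_neg] at h
      · exact h rfl
      · intro e
        apply hne
        rw [← e]; group
    · exact Or.inr (ih h')

theorem length_mul_lt_of_inversionCocycle_ne_zero {w t : W}
    (h : cs.inversionCocycle w t ≠ 0) : cs.length (w * t) < cs.length w := by
  obtain ⟨ω, hω, rfl⟩ := cs.exists_isReduced w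
  exact (cs.isRightInversion_of_mem_rightInvSeq hω
    (cs.mem_rightInvSeq_of_inversionCocycle_ne_zero ω t h)).2

/-- For the converse, the cocycles of w and wt at t differ by 1. If the one of w vanished, t would
shorten wt, contradicting that it shortens w. -/
theorem inversionCocycle_ne_zero_iff {w t : W} (ht : cs.IsReflection t) :
    cs.inversionCocycle w t ≠ 0 ↔ cs.length (w * t) < cs.length w := by
  refine ⟨cs.length_mul_lt_of_inversionCocycle_ne_zero, fun h h0 => ?_⟩
  have h1 := cs.inversionCocycle_mul w t t
  rw [cs.inversionCocycle_self ht, mul_inv_cancel_right, h0, add_zero] at h1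
  have := cs.length_mul_lt_of_inversionCocycle_ne_zero (w := w * t) (t := t) (by rw [h1]; decide)
  rw [mul_assoc, ht.mul_self, mul_one] at this
  omega

theorem IsReflection.length_mul_mul_lt_iff {cs : CoxeterSystem M W} {t : W}
    (ht : cs.IsReflection t) {v : W} (u : W) (hv : cs.length v < cs.length (v * t)) :
    cs.length (u * v * t) < cs.length (u * v) ↔
      cs.length (u * (v * t * v⁻¹)) < cs.length u := by
  rw [← cs.inversionCocycle_ne_zero_iff ht, ← cs.inversionCocycle_ne_zero_iff (ht.conj v),
    inversionCocycle_mul]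
  have : cs.inversionCocycle v t = 0 := by
    by_contra h
    have := (cs.inversionCocycle_ne_zero_iff ht).1 h
    omega
  rw [this, zero_add]

theorem length_mul_simple_mul_lt_iff {u t : W} {i : B} (ht : cs.IsReflection t)
    (hne : t ≠ cs.simple i) :
    cs.length (u * t) < cs.length u ↔
      cs.length (u * t * cs.simple i) < cs.length (u * cs.simple i) := by
  classical
  have ht' : cs.IsReflection (cs.simple i * t * cs.simple i) := by
    simpa using ht.conj (cs.simple i)
  have h : u * t * cs.simple i = u * cs.simple i * (cs.simple i * t * cs.simple i) := by
    simp [mul_assoc]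
  rw [h, ← cs.inversionCocycle_ne_zero_iff ht', ← cs.inversionCocycle_ne_zero_iff ht,
    inversionCocycle_mul, inversionCocycle_simple, if_neg, zero_add]
  · simp [mul_assoc]
  · intro h
    have := congrArg (fun x => cs.simple i * x * cs.simple i) h
    simp [mul_assoc] at this
    exact hne this

end Inversion

/-! ### Distinctness of the simple reflections, by the geometric representation -/

section Geometric

variable {B : Type*} {M : CoxeterMatrix B} {W : Type*} [Group W] (cs : CoxeterSystem M W)

-- The product is a rotation by θ = 2π/m, and its powers are governed by Chebyshev polynomials S at
-- 2 cos θ. The coefficients die because S_{k-1} = 0 there if m = 2k, and S_k + S_{k-1} = 0 if m =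
-- 2k + 1. The argument divides by sin θ, so m = 2 is treated apart.
open Polynomial.Chebyshev in
theorem reflection_mul_reflection_pow_eq_one {V : Type*} [AddCommGroup V] [Module ℝ V] {x y : V}
    {f g : Module.Dual ℝ V} (hf : f x = 2) (hg : g y = 2) {m : ℕ} (hm : 2 ≤ m)
    (hfy : f y = -2 * Real.cos (Real.pi / m)) (hgx : g x = -2 * Real.cos (Real.pi / m)) :
    (Module.reflection hf * Module.reflection hg) ^ m = 1 := by
  ext z
  change _ = z
  rcases hm.eq_or_lt with rfl | hm
  · have h0 : Real.cos (Real.pi / (2 : ℕ)) = 0 := by simp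
    rw [h0, mul_zero] at hfy hgx
    simp [pow_two, LinearEquiv.mul_apply, Module.reflection_apply, hf, hg, hfy, hgx]
    module
  · have hm0 : (m : ℝ) ≠ 0 := by positivity
    set θ : ℝ := 2 * (Real.pi / m) with hθ
    have ht : (2 * Real.cos θ : ℝ) = f y * g x - 2 := by
      rw [hfy, hgx, hθ, Real.cos_two_mul]; ring
    have hsin : Real.sin θ ≠ 0 := by
      apply ne_of_gt
      apply Real.sin_pos_of_pos_of_lt_pi
      · positivity
      · rw [hθ, ← mul_div_assoc, div_lt_iff₀ (by positivity), mul_comm]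
        have : (2 : ℝ) < m := by exact_mod_cast hm
        gcongr
    rw [Module.reflection_mul_reflection_pow_apply hf hg m z _ ht]
    have hS := S_two_mul_real_cos θ
    rcases Nat.even_or_odd' m with ⟨k, hk | hk⟩
    · have h1 : ((m : ℤ) - 2) / 2 = k - 1 := by omega
      have h2 : ((m : ℤ) - 1) / 2 = k - 1 := by omega
      have h3 : (S ℝ ((k : ℤ) - 1)).eval (2 * Real.cos θ) = 0 := by
        have := hS (k - 1)
        have h4 : (((k : ℤ) - 1 : ℤ) + 1 : ℝ) * θ = Real.pi := by
          rw [hθ]; push_cast; field_simp; rw [hk]; push_cast; ring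
        rw [h4, Real.sin_pi] at this
        exact (mul_eq_zero.1 this).resolve_right hsin
      rw [h1, h2, h3]; simp
    · have h1 : ((m : ℤ) - 2) / 2 = k - 1 := by omega
      have h2 : ((m : ℤ) - 1) / 2 = k := by omega
      have h5 : ((m : ℤ) - 3) / 2 = k - 1 := by omega
      have h6 : (m : ℤ) / 2 = k := by omega
      have h3 : (S ℝ (k : ℤ)).eval (2 * Real.cos θ) +
          (S ℝ ((k : ℤ) - 1)).eval (2 * Real.cos θ) = 0 := by
        have h7 := hS (k - 1)
        have h8 := hS k
        have h4 : (((k : ℤ) - 1 : ℤ) + 1 : ℝ) * θ = 2 * Real.pi - ((k : ℤ) + 1 : ℝ) * θ := by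
          rw [hθ]; push_cast; field_simp; rw [hk]; push_cast; ring
        rw [h4, Real.sin_two_pi_sub] at h7
        have : ((S ℝ (k : ℤ)).eval (2 * Real.cos θ) +
          (S ℝ ((k : ℤ) - 1)).eval (2 * Real.cos θ)) * Real.sin θ = 0 := by
          rw [add_mul, h7, h8]; ring
        exact (mul_eq_zero.1 this).resolve_right hsin
      rw [h1, h2, h5, h6, h3]; simp

/-- The functional `2 ⟨αᵢ, ·⟩` of the geometric representation. -/
noncomputable def geometricCoroot (M : CoxeterMatrix B) (i : B) : Module.Dual ℝ (B →₀ ℝ) :=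
  Finsupp.linearCombination ℝ fun j => -2 * Real.cos (Real.pi / M i j)

theorem geometricCoroot_single (i j : B) :
    geometricCoroot M i (Finsupp.single j 1) = -2 * Real.cos (Real.pi / M i j) := by
  simp [geometricCoroot]

theorem geometricCoroot_self (i : B) : geometricCoroot M i (Finsupp.single i 1) = 2 := by
  simp [geometricCoroot_single]

theorem isLiftable_geometric :
    M.IsLiftable fun i => Module.reflection (geometricCoroot_self (M := M) i) := by
  intro i j
  rcases eq_or_ne i j with rfl | hij
  · ext1 z
    simp only [M.diagonal, pow_one, LinearEquiv.mul_apply]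
    exact Module.involutive_reflection _ z
  · rcases Nat.eq_zero_or_pos (M i j) with h | h
    -- The entry 0 encodes infinite order, so the relation is void.
    · simp [h]
    · have := M.off_diagonal i j hij
      exact reflection_mul_reflection_pow_eq_one _ _ (by omega) (geometricCoroot_single i j)
        (by rw [geometricCoroot_single, M.symmetric])

/-- The reflection of i negates the basis vector of i, while any other simple reflection leaves its
i-th coordinate equal to 1. -/
theorem simple_injective : Function.Injective cs.simple := by
  intro i j hij
  by_contra hne
  have h := congrArg (cs.lift ⟨_, isLiftable_geometric⟩) hij
  rw [lift_apply_simple, lift_apply_simple] at h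
  have := congrArg (fun x => (x (Finsupp.single i (1 : ℝ))) i) h
  simp [Module.reflection_apply, hne] at this
  norm_num at this

theorem IsFinitary.finite {cs : CoxeterSystem M W} {I : Set B} (hI : cs.IsFinitary I) :
    I.Finite :=
  Set.Finite.of_finite_image (hI.subset Subgroup.subset_closure) cs.simple_injective.injOn

end Geometric

/-! ### Bruhat order, lifting property and Demazure product -/

section Order

variable {B : Type*} {M : CoxeterMatrix B} {W : Type*} [Group W] (cs : CoxeterSystem M W)

section Bruhat

variable {cs}

theorem BruhatLE.refl (x : W) : cs.BruhatLE x x := Relation.ReflTransGen.refl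

theorem BruhatLE.trans {x y z : W} (h : cs.BruhatLE x y) (h' : cs.BruhatLE y z) :
    cs.BruhatLE x z := Relation.ReflTransGen.trans h h'

theorem IsReflection.bruhatLE_mul {u t : W} (ht : cs.IsReflection t)
    (h : cs.length u < cs.length (u * t)) : cs.BruhatLE u (u * t) :=
  Relation.ReflTransGen.single ⟨t, ht, rfl, h⟩

theorem BruhatLE.eq_or_length_lt {x y : W} (h : cs.BruhatLE x y) :
    x = y ∨ cs.length x < cs.length y := by
  induction h with
  | refl => exact Or.inl rfl
  | tail _ h ih =>
    obtain ⟨t, -, rfl, hl⟩ := h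
    rcases ih with rfl | ih
    · exact Or.inr hl
    · exact Or.inr (ih.trans hl)

theorem BruhatLE.length_le {x y : W} (h : cs.BruhatLE x y) : cs.length x ≤ cs.length y := by
  rcases h.eq_or_length_lt with rfl | h
  · exact le_rfl
  · exact h.le

theorem BruhatLE.antisymm {x y : W} (h : cs.BruhatLE x y) (h' : cs.BruhatLE y x) : x = y :=
  h.eq_or_length_lt.resolve_right (by have := h'.length_le; omega)

theorem BruhatLE.inv {x y : W} (h : cs.BruhatLE x y) : cs.BruhatLE x⁻¹ y⁻¹ := by
  induction h with
  | refl => exact .refl _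
  | @tail v _ _ h ih =>
    obtain ⟨t, ht, rfl, hl⟩ := h
    have e : (v * t)⁻¹ = v⁻¹ * (v * t * v⁻¹) := by rw [mul_inv_rev, ht.inv]; group
    refine ih.trans ?_
    rw [e]
    apply (ht.conj v).bruhatLE_mul
    rw [← e, length_inv, length_inv]
    exact hl

theorem bruhatLE_inv_iff {x y : W} : cs.BruhatLE x⁻¹ y⁻¹ ↔ cs.BruhatLE x y :=
  ⟨fun h => by simpa using h.inv, BruhatLE.inv⟩

variable (cs) in
theorem bruhatLE_mul_simple_total (x : W) (i : B) :
    cs.length x < cs.length (x * cs.simple i) ∧ cs.BruhatLE x (x * cs.simple i) ∨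
      cs.length (x * cs.simple i) < cs.length x ∧ cs.BruhatLE (x * cs.simple i) x := by
  rcases lt_or_gt_of_ne (cs.length_mul_simple_ne x i) with h | h
  · right
    refine ⟨h, ?_⟩
    have := (cs.isReflection_simple i).bruhatLE_mul (u := x * cs.simple i) (by simpa using h)
    simpa using this
  · exact Or.inl ⟨h, (cs.isReflection_simple i).bruhatLE_mul h⟩

theorem IsReflection.length_mul_simple_lt {u t : W} {i : B} (ht : cs.IsReflection t)
    (h : cs.length u < cs.length (u * t)) (hne : t ≠ cs.simple i) :
    cs.length (u * cs.simple i) < cs.length (u * t * cs.simple i) := by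
  have h1 : ¬ cs.length (u * t * cs.simple i) < cs.length (u * cs.simple i) := by
    rw [← cs.length_mul_simple_mul_lt_iff ht hne]; omega
  have ht' : cs.IsReflection (cs.simple i * t * cs.simple i) := by
    simpa using ht.conj (cs.simple i)
  have h2 := ht'.length_mul_left_ne (u * cs.simple i)
  have e : u * cs.simple i * (cs.simple i * t * cs.simple i) = u * t * cs.simple i := by
    simp [mul_assoc]
  rw [e] at h2
  omega

/-- Right multiplication by s turns the step u → ut into the step us → us(sts). Strong exchange
preserves its direction unless t = s. -/
theorem IsReflection.bruhatLE_mul_simple {u t : W} {i : B} (ht : cs.IsReflection t)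
    (h : cs.length u < cs.length (u * t)) (hne : t ≠ cs.simple i) :
    cs.BruhatLE (u * cs.simple i) (u * t * cs.simple i) := by
  have ht' : cs.IsReflection (cs.simple i * t * cs.simple i) := by
    simpa using ht.conj (cs.simple i)
  have e : u * cs.simple i * (cs.simple i * t * cs.simple i) = u * t * cs.simple i := by
    simp [mul_assoc]
  rw [← e]
  apply ht'.bruhatLE_mul
  rw [e]
  exact ht.length_mul_simple_lt h hne

theorem BruhatLE.mul_simple {u v : W} (h : cs.BruhatLE u v) (i : B) :
    cs.BruhatLE (u * cs.simple i) (v * cs.simple i) ∨ cs.BruhatLE (u * cs.simple i) v := by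
  induction h with
  | refl => exact Or.inl (.refl _)
  | tail _ h ih =>
    obtain ⟨t, ht, rfl, hl⟩ := h
    rcases ih with ih | ih
    · by_cases hne : t = cs.simple i
      · right; rw [hne]; exact ih
      · left; exact ih.trans (ht.bruhatLE_mul_simple hl hne)
    · right; exact ih.trans (ht.bruhatLE_mul hl)

/-- The lifting property. -/
theorem BruhatLE.le_mul_simple_of_lt {x y : W} {i : B} (h : cs.BruhatLE x y)
    (hx : cs.length x < cs.length (x * cs.simple i)) :
    cs.BruhatLE x (y * cs.simple i) := by
  induction h with
  | refl => exact (cs.isReflection_simple i).bruhatLE_mul hx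
  | @tail v _ hxv h ih =>
    obtain ⟨t, ht, rfl, hl⟩ := h
    by_cases hne : t = cs.simple i
    · rwa [hne, simple_mul_simple_cancel_right]
    · exact ih.trans (ht.bruhatLE_mul_simple hl hne)

theorem BruhatLE.mul_simple_le_of_lt {x y : W} {i : B} (h : cs.BruhatLE x y)
    (hy : cs.length (y * cs.simple i) < cs.length y) :
    cs.BruhatLE (x * cs.simple i) y := by
  rcases h.mul_simple i with h | h
  · rcases cs.bruhatLE_mul_simple_total y i with h' | h'
    · omega
    · exact h.trans h'.2
  · exact h

/-- Apply lifting to the shorter of u and us. -/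
theorem BruhatLE.le_or_mul_simple_le {u x : W} {i : B} (h : cs.BruhatLE u (x * cs.simple i)) :
    cs.BruhatLE u x ∨ cs.BruhatLE (u * cs.simple i) x := by
  rcases cs.bruhatLE_mul_simple_total u i with hu | hu
  · left
    simpa using h.le_mul_simple_of_lt hu.1
  · right
    simpa using (hu.2.trans h).le_mul_simple_of_lt (i := i) (by simpa using hu.1)

variable (cs) in
theorem one_bruhatLE (x : W) : cs.BruhatLE 1 x := by
  induction x using cs.simple_induction_right with
  | one => exact .refl _
  | mul_simple_right w i ih => exact ih.le_mul_simple_of_lt (by simp)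

end Bruhat

/-- The principal order ideal `{u | u ≤ x}` of the Bruhat order. -/
def bruhatIic (x : W) : Set W := {u | cs.BruhatLE u x}

@[simp]
theorem mem_bruhatIic {u x : W} : u ∈ cs.bruhatIic x ↔ cs.BruhatLE u x := Iff.rfl

theorem bruhatIic_one : cs.bruhatIic 1 = 1 := by
  ext u
  rw [mem_bruhatIic, Set.mem_one]
  refine ⟨fun h => ?_, ?_⟩
  · exact h.antisymm (cs.one_bruhatLE u)
  · rintro rfl; exact .refl _

/-- If xs > x, lifting splits the ideal of xs into elements u with u ≤ x or us ≤ x. If xs < x, the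
ideal of x is already stable under right multiplication by s. -/
theorem bruhatIic_starSimple (x : W) (i : B) :
    cs.bruhatIic (cs.starSimple x i) = cs.bruhatIic x * {1, cs.simple i} := by
  ext u
  have hmem : u ∈ cs.bruhatIic x * {1, cs.simple i} ↔
      cs.BruhatLE u x ∨ cs.BruhatLE (u * cs.simple i) x := by
    simp only [Set.mem_mul, Set.mem_insert_iff, Set.mem_singleton_iff, mem_bruhatIic]
    constructor
    · rintro ⟨a, ha, b, rfl | rfl, rfl⟩
      · left; simpa using ha
      · right; simpa using ha
    · rintro (h | h)
      · exact ⟨u, h, 1, Or.inl rfl, mul_one u⟩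
      · exact ⟨_, h, _, Or.inr rfl, by simp⟩
  rw [hmem, mem_bruhatIic, starSimple]
  rcases cs.bruhatLE_mul_simple_total x i with hx | hx
  · rw [if_pos hx.1]
    refine ⟨BruhatLE.le_or_mul_simple_le, ?_⟩
    rintro (h | h)
    · exact h.trans hx.2
    · have := (h.trans hx.2).mul_simple_le_of_lt (i := i) (by simpa using hx.1)
      simpa using this
  · rw [if_neg (by omega)]
    refine ⟨Or.inl, ?_⟩
    rintro (h | h)
    · exact h
    · simpa using h.mul_simple_le_of_lt hx.1

theorem bruhatIic_foldl_starSimple (ω : List B) (x : W) :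
    cs.bruhatIic (ω.foldl cs.starSimple x) =
      cs.bruhatIic x * (ω.map fun i => ({1, cs.simple i} : Set W)).prod := by
  induction ω generalizing x with
  | nil => simp
  | cons i ω ih => rw [List.foldl_cons, ih, bruhatIic_starSimple, List.map_cons, List.prod_cons,
      mul_assoc]

/-- Additivity of lengths forces every letter to raise the length, so none is absorbed. -/
theorem foldl_starSimple_of_length_add (ω : List B) (x : W)
    (h : cs.length (x * cs.wordProd ω) = cs.length x + ω.length) :
    ω.foldl cs.starSimple x = x * cs.wordProd ω := by
  induction ω generalizing x with
  | nil => simp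
  | cons i ω ih =>
    rw [wordProd_cons, ← mul_assoc, List.length_cons] at h
    have h1 := cs.length_mul_le (x * cs.simple i) (cs.wordProd ω)
    have h2 := cs.length_wordProd_le ω
    have h3 : cs.starSimple x i = x * cs.simple i := if_pos (by omega)
    have h4 := cs.length_mul_le x (cs.simple i)
    rw [length_simple] at h4
    rw [List.foldl_cons, h3, ih _ (by omega), wordProd_cons, mul_assoc]

theorem bruhatIic_wordProd {ω : List B} (hω : cs.IsReduced ω) :
    cs.bruhatIic (cs.wordProd ω) = (ω.map fun i => ({1, cs.simple i} : Set W)).prod := by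
  have := cs.bruhatIic_foldl_starSimple ω 1
  rwa [cs.foldl_starSimple_of_length_add ω 1 (by simpa using hω.eq), bruhatIic_one, one_mul,
    one_mul] at this

/-- Order ideals turn the Demazure product into the product of sets. -/
theorem bruhatIic_star (x y : W) :
    cs.bruhatIic (cs.star x y) = cs.bruhatIic x * cs.bruhatIic y := by
  have h := (cs.exists_isReduced y).choose_spec
  rw [star, bruhatIic_foldl_starSimple, ← cs.bruhatIic_wordProd h.1, ← h.2]

theorem bruhatIic_injective : Function.Injective cs.bruhatIic := by
  intro x y h
  have hx : x ∈ cs.bruhatIic y := h ▸ BruhatLE.refl x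
  have hy : y ∈ cs.bruhatIic x := h ▸ BruhatLE.refl y
  exact BruhatLE.antisymm hx hy

theorem finite_bruhatIic (x : W) : (cs.bruhatIic x).Finite := by
  obtain ⟨ω, hω, rfl⟩ := cs.exists_isReduced x
  rw [cs.bruhatIic_wordProd hω]
  clear hω
  induction ω with
  | nil => simp
  | cons i ω ih =>
    rw [List.map_cons, List.prod_cons]
    exact Set.Finite.mul (by simp) ih

/-! ### Parabolic subgroups and their longest elements -/

section Parabolic

variable {cs}

theorem simple_mem_parabolic {I : Set B} {i : B} (hi : i ∈ I) :
    cs.simple i ∈ cs.parabolic I := Subgroup.subset_closure ⟨i, hi, rfl⟩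

theorem parabolic_mono {I J : Set B} (h : I ⊆ J) : cs.parabolic I ≤ cs.parabolic J :=
  Subgroup.closure_mono (Set.image_mono h)

theorem parabolic_induction_right {I : Set B} {P : W → Prop} {w : W} (hw : P w)
    (h : ∀ x, ∀ i ∈ I, P x → P (x * cs.simple i)) {u : W} (hu : u ∈ cs.parabolic I) :
    P (w * u) := by
  induction hu using Subgroup.closure_induction_right with
  | one => simpa
  | mul_right x _ y hy ih =>
    obtain ⟨i, hi, rfl⟩ := hy
    rw [← mul_assoc]
    exact h _ i hi ih
  | mul_inv_cancel x _ y hy ih =>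
    obtain ⟨i, hi, rfl⟩ := hy
    rw [← mul_assoc, inv_simple]
    exact h _ i hi ih

theorem BruhatLE.le_mul_of_mem_parabolic {J : Set B} {x y u : W}
    (hx : ∀ j ∈ J, cs.length x < cs.length (x * cs.simple j)) (h : cs.BruhatLE x y)
    (hu : u ∈ cs.parabolic J) : cs.BruhatLE x (y * u) :=
  parabolic_induction_right (P := fun z => cs.BruhatLE x z) h
    (fun _ j hj hz => hz.le_mul_simple_of_lt (hx j hj)) hu

theorem BruhatLE.mul_le_of_mem_parabolic {J : Set B} {x y u : W}
    (hy : ∀ j ∈ J, cs.length (y * cs.simple j) < cs.length y) (h : cs.BruhatLE x y)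
    (hu : u ∈ cs.parabolic J) : cs.BruhatLE (x * u) y :=
  parabolic_induction_right (P := fun z => cs.BruhatLE z y) h
    (fun _ j hj hz => hz.mul_simple_le_of_lt (hy j hj)) hu

variable (cs) in
theorem length_inv_mul_simple (x : W) (i : B) :
    cs.length (x⁻¹ * cs.simple i) = cs.length (cs.simple i * x) := by
  rw [← length_inv, mul_inv_rev, inv_inv, inv_simple]

theorem BruhatLE.le_parabolic_mul {I : Set B} {x y u : W}
    (hx : ∀ i ∈ I, cs.length x < cs.length (cs.simple i * x)) (h : cs.BruhatLE x y)
    (hu : u ∈ cs.parabolic I) : cs.BruhatLE x (u * y) := by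
  rw [← bruhatLE_inv_iff, mul_inv_rev]
  refine h.inv.le_mul_of_mem_parabolic (fun i hi => ?_) (inv_mem hu)
  rw [length_inv_mul_simple, length_inv]
  exact hx i hi

theorem BruhatLE.parabolic_mul_le {I : Set B} {x y u : W}
    (hy : ∀ i ∈ I, cs.length (cs.simple i * y) < cs.length y) (h : cs.BruhatLE x y)
    (hu : u ∈ cs.parabolic I) : cs.BruhatLE (u * x) y := by
  rw [← bruhatLE_inv_iff, mul_inv_rev]
  refine h.inv.mul_le_of_mem_parabolic (fun i hi => ?_) (inv_mem hu)
  rw [length_inv_mul_simple, length_inv]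
  exact hy i hi

theorem BruhatLE.mem_parabolic {I : Set B} {u w : W} (h : cs.BruhatLE u w)
    (hw : w ∈ cs.parabolic I) : u ∈ cs.parabolic I := by
  have : ∀ u, cs.BruhatLE u (1 * w) → u ∈ cs.parabolic I := by
    refine parabolic_induction_right (P := fun z => ∀ u, cs.BruhatLE u z → u ∈ cs.parabolic I)
      ?_ ?_ hw
    · intro u hu
      rw [hu.antisymm (cs.one_bruhatLE u)]
      exact one_mem _
    · intro x i hi ih u hu
      rcases hu.le_or_mul_simple_le with hu | hu
      · exact ih u hu
      · have := mul_mem (ih _ hu) (simple_mem_parabolic hi)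
        simpa using this
  exact this u (by simpa using h)

/-- If i ∉ I, no letter of I shortens s_i, so s_i lies below every element of s_i W_I. That coset
would contain 1. -/
theorem mem_of_simple_mem_parabolic {I : Set B} {i : B} (h : cs.simple i ∈ cs.parabolic I) :
    i ∈ I := by
  by_contra hi
  have hd : ∀ j ∈ I, cs.length (cs.simple i) < cs.length (cs.simple i * cs.simple j) := by
    intro j hj
    rcases cs.bruhatLE_mul_simple_total (cs.simple i) j with h' | h'
    · exact h'.1
    · have := h'.1
      rw [length_simple, Nat.lt_one_iff, length_eq_zero_iff, mul_eq_one_iff_eq_inv,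
        inv_simple] at this
      exact absurd (cs.simple_injective this ▸ hj) hi
  have := ((BruhatLE.refl (cs.simple i)).le_mul_of_mem_parabolic hd (inv_mem h)).length_le
  simp at this

theorem IsLongestIn.bruhatIic_eq {I : Set B} {w : W} (h : cs.IsLongestIn I w) :
    cs.bruhatIic w = cs.parabolic I := by
  ext u
  refine ⟨fun hu => BruhatLE.mem_parabolic hu h.1, fun hu => ?_⟩
  have hd : ∀ j ∈ I, cs.length (w * cs.simple j) < cs.length w := fun j hj =>
    lt_of_le_of_ne (h.2 _ (mul_mem h.1 (simple_mem_parabolic hj))) (cs.length_mul_simple_ne w j)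
  simpa using (BruhatLE.refl w).mul_le_of_mem_parabolic hd (mul_mem (inv_mem h.1) hu)

theorem IsLongestIn.unique {I : Set B} {w w' : W} (h : cs.IsLongestIn I w)
    (h' : cs.IsLongestIn I w') : w = w' :=
  cs.bruhatIic_injective (h.bruhatIic_eq.trans h'.bruhatIic_eq.symm)

theorem IsFinitary.bruhatIic_longest {I : Set B} (hI : cs.IsFinitary I) :
    cs.bruhatIic (cs.longest I) = cs.parabolic I := (cs.longest_spec hI).bruhatIic_eq

theorem IsFinitary.subset {I J : Set B} (hI : cs.IsFinitary I) (h : J ⊆ I) : cs.IsFinitary J :=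
  Set.Finite.subset hI (parabolic_mono h)

/-- The ideal of y is finite, contains 1 and is stable under left multiplication by W_I, so it
contains W_I. -/
theorem isFinitary_of_leftDescents {I : Set B} {y : W}
    (hy : ∀ i ∈ I, cs.length (cs.simple i * y) < cs.length y) : cs.IsFinitary I := by
  refine (cs.finite_bruhatIic y).subset fun u hu => ?_
  simpa using (cs.one_bruhatLE y).parabolic_mul_le hy hu

theorem exists_rightDescent_of_mem_parabolic {I : Set B} {u : W} (hu : u ∈ cs.parabolic I)
    (hne : u ≠ 1) : ∃ i ∈ I, cs.length (u * cs.simple i) < cs.length u := by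
  by_contra! h
  have hd : ∀ j ∈ I, cs.length u < cs.length (u * cs.simple j) := fun j hj =>
    lt_of_le_of_ne (h j hj) (cs.length_mul_simple_ne u j).symm
  have := ((BruhatLE.refl u).le_mul_of_mem_parabolic hd (inv_mem hu)).length_le
  simp at this
  exact hne this

/-- Induction over a parabolic subgroup along length-increasing right multiplications. -/
theorem parabolic_length_induction {I : Set B} {P : W → Prop} (one : P 1)
    (mul : ∀ u ∈ cs.parabolic I, ∀ i ∈ I, cs.length u < cs.length (u * cs.simple i) → P u →
      P (u * cs.simple i)) {u : W} (hu : u ∈ cs.parabolic I) : P u := by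
  generalize hn : cs.length u = n
  induction n using Nat.strong_induction_on generalizing u with
  | _ n ih =>
    by_cases h1 : u = 1
    · rwa [h1]
    · obtain ⟨i, hi, hlt⟩ := exists_rightDescent_of_mem_parabolic hu h1
      have hmem := mul_mem hu (simple_mem_parabolic (cs := cs) hi)
      have := mul (u * cs.simple i) hmem i hi (by simpa using hlt)
        (ih _ (by omega) hmem rfl)
      simpa using this

theorem isReflection_conj_simple (u : W) (i : B) : cs.IsReflection (u * cs.simple i * u⁻¹) :=
  ⟨u, i, rfl⟩

/-- Minimality of x means that no reflection u s u⁻¹ in W_J shortens x. By strong exchange, a letter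
that lengthens u then also lengthens xu. -/
theorem length_mul_of_minimal_right {J : Set B} {x u : W}
    (hx : ∀ j ∈ J, cs.length x < cs.length (x * cs.simple j)) (hu : u ∈ cs.parabolic J) :
    cs.length (x * u) = cs.length x + cs.length u := by
  refine parabolic_length_induction (P := fun u => cs.length (x * u) = cs.length x + cs.length u)
    (by simp) (fun u hu j hj hlt ih => ?_) hu
  have h1 := (cs.isReflection_simple j).length_mul_mul_lt_iff x hlt
  have hmem : u * cs.simple j * u⁻¹ ∈ cs.parabolic J :=
    mul_mem (mul_mem hu (simple_mem_parabolic hj)) (inv_mem hu)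
  have h2 := ((BruhatLE.refl x).le_mul_of_mem_parabolic hx hmem).length_le
  rw [← mul_assoc]
  have h3 := cs.length_mul_simple (x * u) j
  have h4 := cs.length_mul_simple u j
  omega

theorem length_mul_of_minimal_left {I : Set B} {x u : W}
    (hx : ∀ i ∈ I, cs.length x < cs.length (cs.simple i * x)) (hu : u ∈ cs.parabolic I) :
    cs.length (u * x) = cs.length u + cs.length x := by
  have := length_mul_of_minimal_right (cs := cs) (J := I) (x := x⁻¹) (u := u⁻¹) (fun i hi => by
    rw [length_inv_mul_simple, length_inv]; exact hx i hi) (inv_mem hu)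
  rw [← mul_inv_rev, length_inv, length_inv, length_inv] at this
  omega

/-- Dual to the minimal case: every reflection in W_I shortens w, so a letter that lengthens u
shortens wu. -/
theorem IsLongestIn.length_mul {I : Set B} {w u : W} (h : cs.IsLongestIn I w)
    (hu : u ∈ cs.parabolic I) : cs.length (w * u) + cs.length u = cs.length w := by
  refine parabolic_length_induction (P := fun u => cs.length (w * u) + cs.length u = cs.length w)
    (by simp) (fun u hu j hj hlt ih => ?_) hu
  have h1 := (cs.isReflection_simple j).length_mul_mul_lt_iff w hlt
  have hmem : u * cs.simple j * u⁻¹ ∈ cs.parabolic I :=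
    mul_mem (mul_mem hu (simple_mem_parabolic hj)) (inv_mem hu)
  have h2 := h.2 _ (mul_mem h.1 hmem)
  have h5 := (isReflection_conj_simple (cs := cs) u j).length_mul_left_ne w
  rw [← mul_assoc]
  have h3 := cs.length_mul_simple (w * u) j
  have h4 := cs.length_mul_simple u j
  omega

theorem IsLongestIn.inv {I : Set B} {w : W} (h : cs.IsLongestIn I w) : cs.IsLongestIn I w⁻¹ :=
  ⟨inv_mem h.1, fun v hv => by rw [length_inv]; exact h.2 v hv⟩

theorem IsLongestIn.length_mul_left {I : Set B} {w u : W} (h : cs.IsLongestIn I w)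
    (hu : u ∈ cs.parabolic I) : cs.length (u * w) + cs.length u = cs.length w := by
  have := h.inv.length_mul (inv_mem hu)
  rwa [← mul_inv_rev, length_inv, length_inv, length_inv] at this

end Parabolic

end Order

/-! ### Double cosets, their extremal elements and subordinate paths -/

section DoubleCosets

variable {B : Type*} {M : CoxeterMatrix B} {W : Type*} [Group W] {cs : CoxeterSystem M W}

theorem IsMaxIn.maxRep {r : Set W} {x : W} (hx : cs.IsMaxIn r x) :
    cs.IsMaxIn r (cs.maxRep r) := Classical.epsilon_spec ⟨x, hx⟩

theorem IsMinIn.minRep {r : Set W} {x : W} (hx : cs.IsMinIn r x) :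
    cs.IsMinIn r (cs.minRep r) := Classical.epsilon_spec ⟨x, hx⟩

theorem IsCoset.eq_of_mem {I J : Set B} {r : Set W} (hr : cs.IsCoset I J r) {w : W} (hw : w ∈ r) :
    r = DoubleCoset.doubleCoset w (cs.parabolic I : Set W) (cs.parabolic J : Set W) := by
  obtain ⟨v, rfl⟩ := hr
  exact (DoubleCoset.doubleCoset_eq_of_mem hw).symm

theorem IsCoset.nonempty {I J : Set B} {r : Set W} (hr : cs.IsCoset I J r) : r.Nonempty := by
  obtain ⟨v, rfl⟩ := hr
  exact ⟨v, DoubleCoset.mem_doubleCoset_self _ _ _⟩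

theorem IsCoset.mul_mem {I J : Set B} {r : Set W} (hr : cs.IsCoset I J r) {w u v : W} (hw : w ∈ r)
    (hu : u ∈ cs.parabolic I) (hv : v ∈ cs.parabolic J) : u * w * v ∈ r := by
  rw [hr.eq_of_mem hw]
  exact DoubleCoset.mem_doubleCoset.2 ⟨u, hu, v, hv, rfl⟩

theorem IsCoset.mul_mem_left {I J : Set B} {r : Set W} (hr : cs.IsCoset I J r) {w u : W}
    (hw : w ∈ r) (hu : u ∈ cs.parabolic I) : u * w ∈ r := by
  simpa using hr.mul_mem hw hu (one_mem _)

theorem IsCoset.mul_mem_right {I J : Set B} {r : Set W} (hr : cs.IsCoset I J r) {w v : W}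
    (hw : w ∈ r) (hv : v ∈ cs.parabolic J) : w * v ∈ r := by
  simpa using hr.mul_mem hw (one_mem _) hv

theorem IsCoset.subset_of_mem {I J : Set B} {r : Set W} (hr : cs.IsCoset I J r) {w : W}
    (hw : w ∈ r) {X : Set W}
    (hX : ∀ u ∈ cs.parabolic I, ∀ v ∈ cs.parabolic J, u * w * v ∈ X) : r ⊆ X := by
  rw [hr.eq_of_mem hw]
  intro x hx
  obtain ⟨u, hu, v, hv, rfl⟩ := DoubleCoset.mem_doubleCoset.1 hx
  exact hX u hu v hv

theorem IsCoset.finite {I J : Set B} {r : Set W} (hr : cs.IsCoset I J r) (hI : cs.IsFinitary I)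
    (hJ : cs.IsFinitary J) : r.Finite := by
  obtain ⟨v, rfl⟩ := hr
  exact (Set.Finite.mul hI (Set.finite_singleton v)).mul hJ

theorem IsCoset.isMaxIn {I J : Set B} {r : Set W} (hr : cs.IsCoset I J r) {m : W} (hm : m ∈ r)
    (hI : ∀ i ∈ I, cs.length (cs.simple i * m) < cs.length m)
    (hJ : ∀ j ∈ J, cs.length (m * cs.simple j) < cs.length m) : cs.IsMaxIn r m :=
  ⟨hm, hr.subset_of_mem (X := cs.bruhatIic m) hm fun _ hu _ hv =>
    ((BruhatLE.refl m).parabolic_mul_le hI hu).mul_le_of_mem_parabolic hJ hv⟩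

theorem IsCoset.isMinIn {I J : Set B} {r : Set W} (hr : cs.IsCoset I J r) {d : W} (hd : d ∈ r)
    (hI : ∀ i ∈ I, cs.length d < cs.length (cs.simple i * d))
    (hJ : ∀ j ∈ J, cs.length d < cs.length (d * cs.simple j)) : cs.IsMinIn r d :=
  ⟨hd, hr.subset_of_mem (X := {x | cs.BruhatLE d x}) hd fun _ hu _ hv =>
    ((BruhatLE.refl d).le_parabolic_mul hI hu).le_mul_of_mem_parabolic hJ hv⟩

theorem IsMaxIn.leftDescent {I J : Set B} {r : Set W} (hr : cs.IsCoset I J r) {m : W}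
    (hm : cs.IsMaxIn r m) (i : B) (hi : i ∈ I) : cs.length (cs.simple i * m) < cs.length m :=
  lt_of_le_of_ne (hm.2 _ (hr.mul_mem_left hm.1 (simple_mem_parabolic hi))).length_le
    (cs.length_simple_mul_ne m i)

theorem IsMaxIn.rightDescent {I J : Set B} {r : Set W} (hr : cs.IsCoset I J r) {m : W}
    (hm : cs.IsMaxIn r m) (j : B) (hj : j ∈ J) : cs.length (m * cs.simple j) < cs.length m :=
  lt_of_le_of_ne (hm.2 _ (hr.mul_mem_right hm.1 (simple_mem_parabolic hj))).length_le
    (cs.length_mul_simple_ne m j)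

theorem IsMinIn.leftAscent {I J : Set B} {r : Set W} (hr : cs.IsCoset I J r) {d : W}
    (hd : cs.IsMinIn r d) (i : B) (hi : i ∈ I) : cs.length d < cs.length (cs.simple i * d) :=
  lt_of_le_of_ne (hd.2 _ (hr.mul_mem_left hd.1 (simple_mem_parabolic hi))).length_le
    (cs.length_simple_mul_ne d i).symm

theorem IsMinIn.rightAscent {I J : Set B} {r : Set W} (hr : cs.IsCoset I J r) {d : W}
    (hd : cs.IsMinIn r d) (j : B) (hj : j ∈ J) : cs.length d < cs.length (d * cs.simple j) :=
  lt_of_le_of_ne (hd.2 _ (hr.mul_mem_right hd.1 (simple_mem_parabolic hj))).length_le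
    (cs.length_mul_simple_ne d j).symm

theorem IsCoset.exists_isMaxIn {I J : Set B} {r : Set W} (hr : cs.IsCoset I J r)
    (hI : cs.IsFinitary I) (hJ : cs.IsFinitary J) : ∃ m, cs.IsMaxIn r m := by
  obtain ⟨m, hm, h⟩ := Set.exists_max_image r cs.length (hr.finite hI hJ) hr.nonempty
  refine ⟨m, hr.isMaxIn hm (fun i hi => ?_) (fun j hj => ?_)⟩
  · exact lt_of_le_of_ne (h _ (hr.mul_mem_left hm (simple_mem_parabolic hi)))
      (cs.length_simple_mul_ne m i)
  · exact lt_of_le_of_ne (h _ (hr.mul_mem_right hm (simple_mem_parabolic hj)))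
      (cs.length_mul_simple_ne m j)

theorem IsCoset.exists_isMinIn {I J : Set B} {r : Set W} (hr : cs.IsCoset I J r) :
    ∃ d, cs.IsMinIn r d := by
  have hs := hr.nonempty
  let d := Function.argminOn cs.length r hs
  have hd : d ∈ r := Function.argminOn_mem _ _ hs
  have h : ∀ x ∈ r, cs.length d ≤ cs.length x := fun x hx => Function.argminOn_le _ _ hx
  refine ⟨d, hr.isMinIn hd (fun i hi => ?_) (fun j hj => ?_)⟩
  · exact lt_of_le_of_ne (h _ (hr.mul_mem_left hd (simple_mem_parabolic hi)))
      (cs.length_simple_mul_ne d i).symm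
  · exact lt_of_le_of_ne (h _ (hr.mul_mem_right hd (simple_mem_parabolic hj)))
      (cs.length_mul_simple_ne d j).symm

theorem IsCoset.isMaxIn_maxRep {I J : Set B} {r : Set W} (hr : cs.IsCoset I J r)
    (hI : cs.IsFinitary I) (hJ : cs.IsFinitary J) : cs.IsMaxIn r (cs.maxRep r) :=
  (hr.exists_isMaxIn hI hJ).choose_spec.maxRep

theorem IsCoset.isMinIn_minRep {I J : Set B} {r : Set W} (hr : cs.IsCoset I J r) :
    cs.IsMinIn r (cs.minRep r) :=
  hr.exists_isMinIn.choose_spec.minRep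

theorem IsMaxIn.subset_bruhatIic_iff {I J : Set B} {p q : Set W} (hq : cs.IsCoset I J q)
    (hp : cs.IsCoset I J p) {m x : W} (hm : cs.IsMaxIn q m) (hx : x ∈ p) :
    cs.BruhatLE x m ↔ p ⊆ cs.bruhatIic m :=
  ⟨fun h => hp.subset_of_mem hx fun _ hu _ hv =>
      (h.parabolic_mul_le (hm.leftDescent hq) hu).mul_le_of_mem_parabolic (hm.rightDescent hq) hv,
    fun h => h hx⟩

theorem bruhatLE_of_mem_of_isMinIn {I J : Set B} {p q : Set W} (hp : cs.IsCoset I J p)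
    (hq : cs.IsCoset I J q) {d e x : W} (hd : cs.IsMinIn p d) (he : cs.IsMinIn q e)
    (hx : x ∈ q) (h : cs.BruhatLE d x) : cs.BruhatLE d e := by
  have : q ⊆ {y | cs.BruhatLE d y} := hq.subset_of_mem hx fun _ hu _ hv =>
    (h.le_parabolic_mul (hd.leftAscent hp) hu).le_mul_of_mem_parabolic (hd.rightAscent hp) hv
  exact this he.1

/-- Both conditions are equivalent to d ≤ n: the ideal below n absorbs all of p, and the elements
above d absorb all of q. -/
theorem bruhatLE_max_iff_min {I J : Set B} {p q : Set W} (hp : cs.IsCoset I J p)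
    (hq : cs.IsCoset I J q) {m n d e : W} (hm : cs.IsMaxIn p m) (hn : cs.IsMaxIn q n)
    (hd : cs.IsMinIn p d) (he : cs.IsMinIn q e) : cs.BruhatLE m n ↔ cs.BruhatLE d e := by
  rw [hn.subset_bruhatIic_iff hq hp hm.1, ← hn.subset_bruhatIic_iff hq hp hd.1]
  exact ⟨bruhatLE_of_mem_of_isMinIn hp hq hd he hn.1, fun h => h.trans (he.2 _ hn.1)⟩

/-- The set `W_{I₀} W_{I₁} ⋯ W_{Iₙ}`. -/
def parabolicProd (cs : CoxeterSystem M W) (I : ℕ → Set B) : ℕ → Set W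
  | 0 => cs.parabolic (I 0)
  | n + 1 => parabolicProd cs I n * cs.parabolic (I (n + 1))

theorem mul_mem_parabolicProd {I : ℕ → Set B} {n : ℕ} {x u : W} (hx : x ∈ cs.parabolicProd I n)
    (hu : u ∈ cs.parabolic (I n)) : x * u ∈ cs.parabolicProd I n := by
  cases n with
  | zero => exact (cs.parabolic (I 0)).mul_mem hx hu
  | succ n =>
    obtain ⟨a, ha, b, hb, rfl⟩ := hx
    exact ⟨a, ha, b * u, (cs.parabolic (I (n + 1))).mul_mem hb hu, (mul_assoc a b u).symm⟩

theorem bruhatIic_foldl_star (l : List W) (x : W) :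
    cs.bruhatIic (l.foldl cs.star x) = cs.bruhatIic x * (l.map cs.bruhatIic).prod := by
  induction l generalizing x with
  | nil => simp
  | cons y l ih => rw [List.foldl_cons, ih, bruhatIic_star, List.map_cons, List.prod_cons,
      mul_assoc]

theorem parabolicProd_eq_prod (I : ℕ → Set B) (n : ℕ) :
    cs.parabolicProd I n =
      (List.ofFn fun k : Fin (n + 1) => (cs.parabolic (I k) : Set W)).prod := by
  induction n with
  | zero => simp [parabolicProd]
  | succ n ih =>
    rw [List.ofFn_succ', List.concat_eq_append, List.prod_append, List.prod_singleton,
      parabolicProd, ih]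
    rfl

/-- The termini of paths subordinate to `I₀, …, Iₙ` are the cosets in `W_{I₀} ⋯ W_{Iₙ}`. -/
theorem exists_path_iff_subset_parabolicProd (I : ℕ → Set B) (n : ℕ)
    (h : ∀ k < n, I k ⊆ I (k + 1) ∨ I (k + 1) ⊆ I k) (p : Set W) :
    (∃ path : ℕ → Set W, (∀ k ≤ n, cs.IsCoset (I 0) (I k) (path k)) ∧ 1 ∈ path 0 ∧
      (∀ k < n, I k ⊆ I (k + 1) → path k ⊆ path (k + 1)) ∧
      (∀ k < n, I (k + 1) ⊆ I k → path (k + 1) ⊆ path k) ∧ path n = p) ↔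
    cs.IsCoset (I 0) (I n) p ∧ p ⊆ cs.parabolicProd I n := by
  induction n generalizing p with
  | zero =>
    have hself : (cs.parabolic (I 0) : Set W) = DoubleCoset.doubleCoset 1
        (cs.parabolic (I 0) : Set W) (cs.parabolic (I 0) : Set W) := by
      ext x
      rw [DoubleCoset.mem_doubleCoset]
      refine ⟨fun hx => ⟨x, hx, 1, one_mem _, by simp⟩, ?_⟩
      rintro ⟨u, hu, v, hv, rfl⟩
      exact (cs.parabolic (I 0)).mul_mem (mul_mem hu (one_mem _)) hv
    constructor
    · rintro ⟨path, h1, h2, -, -, rfl⟩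
      refine ⟨h1 0 le_rfl, ?_⟩
      rw [(h1 0 le_rfl).eq_of_mem h2, ← hself]
      rfl
    · rintro ⟨h1, h2⟩
      refine ⟨fun _ => p, fun k hk => ?_, ?_, by simp, by simp, rfl⟩
      · obtain rfl : k = 0 := by omega
        exact h1
      · obtain ⟨x, hx⟩ := h1.nonempty
        have := h1.mul_mem_left hx (inv_mem (h2 hx : x ∈ cs.parabolic (I 0)))
        simpa using this
  | succ n ih =>
    have ih := ih (fun k hk => h k (by omega))
    constructor
    · rintro ⟨path, h1, h2, h3, h4, rfl⟩
      refine ⟨h1 _ le_rfl, ?_⟩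
      obtain ⟨h5, h6⟩ := (ih (path n)).1 ⟨path, fun k hk => h1 k (by omega), h2,
        fun k hk => h3 k (by omega), fun k hk => h4 k (by omega), rfl⟩
      rw [parabolicProd]
      rcases h n (by omega) with hn | hn
      · obtain ⟨x, hx⟩ := h5.nonempty
        refine (h1 (n + 1) le_rfl).subset_of_mem (h3 n (by omega) hn hx) fun u hu v hv => ?_
        exact Set.mul_mem_mul (h6 (h5.mul_mem_left hx hu)) hv
      · intro x hx
        exact ⟨x, h6 (h4 n (by omega) hn hx), 1, one_mem (cs.parabolic _), mul_one x⟩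
    · rintro ⟨h1, h2⟩
      obtain ⟨x, hx⟩ := h1.nonempty
      obtain ⟨a, ha, b, hb, rfl⟩ := h2 hx
      have hap : a ∈ p := by simpa using h1.mul_mem_right hx (inv_mem hb)
      -- The preceding coset of the path is the one through a, where ab ∈ p with b in the last
      -- parabolic factor. It shares a with p, so it is comparable to p in the direction of the
      -- step.
      set r : Set W := DoubleCoset.doubleCoset a (cs.parabolic (I 0)) (cs.parabolic (I n)) with hr
      have har : a ∈ r := DoubleCoset.mem_doubleCoset_self _ _ _
      have hrc : cs.IsCoset (I 0) (I n) r := ⟨a, rfl⟩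
      have hstep : (I n ⊆ I (n + 1) → r ⊆ p) ∧ (I (n + 1) ⊆ I n → p ⊆ r) := by
        refine ⟨fun hn => ?_, fun hn => ?_⟩
        · exact hrc.subset_of_mem har fun u hu v hv => h1.mul_mem hap hu (parabolic_mono hn hv)
        · exact h1.subset_of_mem hap fun u hu v hv => hrc.mul_mem har hu (parabolic_mono hn hv)
      have hmem : ∀ k, ∀ u ∈ cs.parabolic (I 0), ∀ y ∈ cs.parabolicProd I k,
          u * y ∈ cs.parabolicProd I k := by
        intro k u hu
        induction k with
        | zero => exact fun y hy => (cs.parabolic (I 0)).mul_mem hu hy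
        | succ k ihk =>
          rintro _ ⟨c, hc, e, he, rfl⟩
          exact ⟨u * c, ihk c hc, e, he, mul_assoc u c e⟩
      obtain ⟨path, h3, h4, h5, h6, h7⟩ := (ih r).2 ⟨hrc, hrc.subset_of_mem har fun u hu v hv =>
        mul_mem_parabolicProd (hmem n u hu a ha) hv⟩
      have hne : ∀ k ≤ n, Function.update path (n + 1) p k = path k := fun k hk =>
        Function.update_of_ne (by omega) _ _
      refine ⟨Function.update path (n + 1) p, fun k hk => ?_, ?_, fun k hk => ?_, fun k hk => ?_,
        Function.update_self _ _ _⟩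
      · rcases Nat.lt_or_eq_of_le hk with hk | rfl
        · rw [hne k (by omega)]; exact h3 k (by omega)
        · rw [Function.update_self]; exact h1
      · rw [hne 0 (by omega)]; exact h4
      · rcases Nat.lt_or_eq_of_le (Nat.lt_succ_iff.1 hk) with hk | rfl
        · rw [hne k (by omega), hne (k + 1) (by omega)]; exact h5 k hk
        · rw [hne k le_rfl, Function.update_self, h7]; exact hstep.1
      · rcases Nat.lt_or_eq_of_le (Nat.lt_succ_iff.1 hk) with hk | rfl
        · rw [hne k (by omega), hne (k + 1) (by omega)]; exact h6 k hk
        · rw [hne k le_rfl, Function.update_self, h7]; exact hstep.2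

namespace SinglestepExpr

theorem bruhatIic_foldl (E : cs.SinglestepExpr) :
    cs.bruhatIic ((List.ofFn fun k => cs.longest (E.set k)).foldl cs.star 1) =
      (List.ofFn fun k => (cs.parabolic (E.set k) : Set W)).prod := by
  rw [bruhatIic_foldl_star, bruhatIic_one, one_mul, List.map_ofFn]
  congr 2
  ext1 k
  exact (E.finitary k).bruhatIic_longest

theorem isTerminus_iff (E : cs.SinglestepExpr) (p : Set W) :
    E.IsTerminus p ↔ cs.IsCoset E.first E.last p ∧
      p ⊆ (List.ofFn fun k => (cs.parabolic (E.set k) : Set W)).prod := by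
  -- Indices beyond the width wrap around, but only those up to the width are used.
  let I : ℕ → Set B := fun k => E.set (Fin.ofNat _ k)
  have hI : ∀ k : Fin (E.width + 1), I k = E.set k := fun k => by simp [I]
  have hIs : ∀ k : Fin E.width, I (k + 1) = E.set k.succ := fun k => hI k.succ
  have hIc : ∀ k : Fin E.width, I k = E.set k.castSucc := fun k => hI k.castSucc
  have hprod : (List.ofFn fun k => (cs.parabolic (E.set k) : Set W)).prod =
      cs.parabolicProd I E.width := by
    rw [parabolicProd_eq_prod]
    simp only [hI]
  have hstep : ∀ k < E.width, I k ⊆ I (k + 1) ∨ I (k + 1) ⊆ I k := by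
    intro k hk
    rw [hIs ⟨k, hk⟩, hIc ⟨k, hk⟩]
    obtain ⟨s, ⟨-, h⟩ | ⟨-, h⟩⟩ := E.step ⟨k, hk⟩
    · left; rw [h]; exact Set.subset_union_left
    · right; rw [h]; exact Set.sdiff_subset
  have h0 : I 0 = E.first := hI 0
  have hl : I E.width = E.last := hI (Fin.last _)
  rw [hprod, ← h0, ← hl, ← exists_path_iff_subset_parabolicProd I _ hstep]
  constructor
  · rintro ⟨path, ⟨h1, h2, h3, h4⟩, h5⟩
    have e : ∀ k : Fin (E.width + 1), path (Fin.ofNat _ (k : ℕ)) = path k := fun k => by simp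
    refine ⟨fun k => path (Fin.ofNat _ k), fun k hk => ?_, ?_, fun k hk => ?_, fun k hk => ?_, ?_⟩
    · rw [h0]; exact h1 _
    · exact h2
    · have := h3 ⟨k, hk⟩
      rw [← hIs, ← hIc, ← e (Fin.castSucc _), ← e (Fin.succ _)] at this
      exact this
    · have := h4 ⟨k, hk⟩
      rw [← hIs, ← hIc, ← e (Fin.castSucc _), ← e (Fin.succ _)] at this
      exact this
    · rw [← h5]; exact e (Fin.last _)
  · rintro ⟨path, h1, h2, h3, h4, h5⟩
    refine ⟨fun k => path k, ⟨fun k => ?_, h2, fun k hk => ?_, fun k hk => ?_⟩, h5⟩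
    · have := h1 k (by omega)
      rwa [h0, hI] at this
    · rw [← hIs, ← hIc] at hk
      exact h3 k k.2 hk
    · rw [← hIs, ← hIc] at hk
      exact h4 k k.2 hk

theorem Expresses.isTerminus_iff {E : cs.SinglestepExpr} {I J : Set B} {p q : Set W}
    (h : E.Expresses I J q) (hI : cs.IsFinitary I) (hJ : cs.IsFinitary J)
    (hp : cs.IsCoset I J p) :
    E.IsTerminus p ↔ cs.BruhatLE (cs.maxRep p) (cs.maxRep q) := by
  obtain ⟨rfl, rfl, hq, hmax⟩ := h
  rw [E.isTerminus_iff, ← E.bruhatIic_foldl, ← hmax,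
    (hq.isMaxIn_maxRep hI hJ).subset_bruhatIic_iff hq hp
    (hp.isMaxIn_maxRep hI hJ).1]
  exact and_iff_right hp

end SinglestepExpr

end DoubleCosets

/-! ### Existence of reduced expressions -/

section ReducedExpressions

variable {B : Type*} {M : CoxeterMatrix B} {W : Type*} [Group W] {cs : CoxeterSystem M W}

theorem IsFinitary.length_mul_longest {J : Set B} (hJ : cs.IsFinitary J) {d : W}
    (hd : ∀ j ∈ J, cs.length d < cs.length (d * cs.simple j)) :
    cs.length (d * cs.longest J) = cs.length d + cs.length (cs.longest J) :=
  length_mul_of_minimal_right hd (cs.longest_spec hJ).1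

theorem IsFinitary.rightDescent_mul_longest {J : Set B} (hJ : cs.IsFinitary J) {d : W}
    (hd : ∀ j ∈ J, cs.length d < cs.length (d * cs.simple j)) (j : B) (hj : j ∈ J) :
    cs.length (d * cs.longest J * cs.simple j) < cs.length (d * cs.longest J) := by
  have hw := cs.longest_spec hJ
  rw [hJ.length_mul_longest hd, mul_assoc, length_mul_of_minimal_right hd
    (mul_mem hw.1 (simple_mem_parabolic hj))]
  have := hw.length_mul (simple_mem_parabolic hj)
  rw [length_simple] at this
  omega

/-- If `w_I v` is maximal for right multiplication by `J`, then increasing `v` by an element of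
`W_J` amounts to multiplying it from the left by an element of `W_K`, where
`K = {i ∈ I | v⁻¹ sᵢ v ∈ W_J}`. -/
theorem exists_mul_eq_mul_of_maximal {I J : Set B} (hI : cs.IsFinitary I) {v c : W}
    (hv : ∀ i ∈ I, cs.length v < cs.length (cs.simple i * v))
    (hm : ∀ j ∈ J, cs.length (cs.longest I * v * cs.simple j) < cs.length (cs.longest I * v))
    (hc : c ∈ cs.parabolic J) (hlen : cs.length (v * c) = cs.length v + cs.length c) :
    ∃ a ∈ cs.parabolic {i ∈ I | v⁻¹ * cs.simple i * v ∈ cs.parabolic J}, v * c = a * v := by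
  revert hlen
  refine parabolic_length_induction (P := fun c => cs.length (v * c) = cs.length v + cs.length c →
    ∃ a ∈ cs.parabolic {i ∈ I | v⁻¹ * cs.simple i * v ∈ cs.parabolic J}, v * c = a * v)
    (fun _ => ⟨1, one_mem _, by simp⟩) (fun c hc j hj hlt ih hlen => ?_) hc
  have hcj := cs.length_mul_simple c j
  have h1 := cs.length_mul_le v c
  have h2 := cs.length_mul_le (v * c) (cs.simple j)
  rw [length_simple] at h2
  rw [← mul_assoc] at hlen ⊢
  obtain ⟨a, ha, hac⟩ := ih (by omega)
  have haI := parabolic_mono (Set.sep_subset _ _) ha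
  have hav := length_mul_of_minimal_left hv haI
  have hvj : cs.length v < cs.length (v * cs.simple j) := by
    rcases cs.bruhatLE_mul_simple_total v j with h | h
    · exact h.1
    · have h3 := cs.length_mul_le a (v * cs.simple j)
      rw [← mul_assoc, ← hac] at h3
      rw [← hac] at hav
      omega
  set t := v * cs.simple j * v⁻¹ with ht
  -- Since t v = v s_j, the descent j of w_I v makes t shorten w_I, which places t in W_I.
  have hwt : cs.length (cs.longest I * t) < cs.length (cs.longest I) :=
    ((cs.isReflection_simple j).length_mul_mul_lt_iff _ hvj).1 (hm j hj)
  have htr : cs.IsReflection t := isReflection_conj_simple v j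
  have htI : t ∈ cs.parabolic I := by
    have h4 := htr.bruhatLE_mul (u := cs.longest I * t)
      (by rwa [mul_assoc, htr.mul_self, mul_one])
    rw [mul_assoc, htr.mul_self, mul_one] at h4
    have hw := (cs.longest_spec hI).1
    have := mul_mem (inv_mem hw) (h4.mem_parabolic hw)
    simpa using this
  have htv : t * v = v * cs.simple j := by rw [ht]; group
  -- As v is minimal in W_I v, ℓ(t) = ℓ(v s_j) − ℓ(v) = 1, so t is simple.
  have hlt1 : cs.length t = 1 := by
    have h5 := length_mul_of_minimal_left hv htI
    have h6 := cs.length_mul_simple v j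
    rw [htv] at h5
    omega
  obtain ⟨i, hi⟩ := cs.length_eq_one_iff.1 hlt1
  refine ⟨a * cs.simple i, mul_mem ha (simple_mem_parabolic ⟨?_, ?_⟩), ?_⟩
  · exact mem_of_simple_mem_parabolic (hi ▸ htI)
  · rw [← hi, mul_assoc, htv, inv_mul_cancel_left]
    exact simple_mem_parabolic hj
  · rw [hac, ← hi, mul_assoc, mul_assoc, htv]

/-- The decomposition of the maximal element `m` of a double coset along a subset `K` of `I`: one
has `m = w_I v` and `w_K v = d w_J`, where all products are reduced. -/
theorem IsMaxIn.exists_decomposition {I J : Set B} (hI : cs.IsFinitary I) (hJ : cs.IsFinitary J)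
    {q : Set W} (hq : cs.IsCoset I J q) {m : W} (hm : cs.IsMaxIn q m) :
    ∃ K ⊆ I, ∃ v d : W, m = cs.longest I * v ∧
      (∀ i ∈ I, cs.length v < cs.length (cs.simple i * v)) ∧
      (∀ i ∈ I, cs.length d < cs.length (cs.simple i * d)) ∧
      (∀ j ∈ J, cs.length d < cs.length (d * cs.simple j)) ∧
      cs.longest K * v = d * cs.longest J ∧ d * cs.longest J ∈ q := by
  have hwI := cs.longest_spec hI
  have hwJ := cs.longest_spec hJ
  -- One-sided cosets are treated as double cosets with an empty set on the other side.
  have hcI : cs.IsCoset I ∅ (DoubleCoset.doubleCoset m (cs.parabolic I) (cs.parabolic ∅)) :=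
    ⟨m, rfl⟩
  have hbot : cs.parabolic (∅ : Set B) = ⊥ := by simp [parabolic]
  obtain ⟨v, hv⟩ := hcI.exists_isMinIn
  have hvI := hv.leftAscent hcI
  obtain ⟨a, ha, b, hb, hvab⟩ := DoubleCoset.mem_doubleCoset.1 hv.1
  rw [hbot] at hb
  obtain rfl : b = 1 := hb
  rw [mul_one] at hvab
  have hvq : v ∈ q := hvab ▸ hq.mul_mem_left hm.1 ha
  have hmv : m = cs.longest I * v := by
    have e : m = a⁻¹ * v := by rw [hvab]; group
    have hl := length_mul_of_minimal_left hvI (inv_mem ha)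
    have hl' := length_mul_of_minimal_left hvI hwI.1
    have := (hm.2 _ (hq.mul_mem_left hvq hwI.1)).length_le
    have : cs.IsLongestIn I a⁻¹ := ⟨inv_mem ha, fun u hu => (hwI.2 u hu).trans (by
      rw [← e] at hl; omega)⟩
    rw [e, this.unique hwI]
  have hcJ : cs.IsCoset ∅ J (DoubleCoset.doubleCoset v (cs.parabolic ∅) (cs.parabolic J)) :=
    ⟨v, rfl⟩
  obtain ⟨d, hd⟩ := hcJ.exists_isMinIn
  have hdJ := hd.rightAscent hcJ
  obtain ⟨a', ha', b, hb, hdvb⟩ := DoubleCoset.mem_doubleCoset.1 hd.1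
  rw [hbot] at ha'
  obtain rfl : a' = 1 := ha'
  rw [one_mul] at hdvb
  have hdq : d ∈ q := hdvb ▸ hq.mul_mem_right hvq hb
  have hvd : v = d * b⁻¹ := by rw [hdvb]; group
  have hvl := length_mul_of_minimal_right hdJ (inv_mem hb)
  rw [← hvd] at hvl
  have hdI : ∀ i ∈ I, cs.length d < cs.length (cs.simple i * d) := by
    intro i hi
    have h1 := hvI i hi
    have h2 := cs.length_mul_le (cs.simple i * d) b⁻¹
    rw [mul_assoc, ← hvd] at h2
    omega
  set c := b * cs.longest J with hc
  have hcmem : c ∈ cs.parabolic J := mul_mem hb hwJ.1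
  have hy : d * cs.longest J = v * c := by rw [hvd, hc]; group
  have hyl := hJ.length_mul_longest hdJ
  have hcl := hwJ.length_mul_left hb
  rw [← hc] at hcl
  have hlen : cs.length (v * c) = cs.length v + cs.length c := by
    rw [← hy, hyl, hvl, length_inv]
    omega
  obtain ⟨a, haK, hvc⟩ := exists_mul_eq_mul_of_maximal hI hvI
    (by rw [← hmv]; exact hm.rightDescent hq) hcmem hlen
  set K := {i ∈ I | v⁻¹ * cs.simple i * v ∈ cs.parabolic J} with hK
  have hKI : K ⊆ I := Set.sep_subset _ _
  have hconj : ∀ u ∈ cs.parabolic K, v⁻¹ * u * v ∈ cs.parabolic J := by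
    have : cs.parabolic K ≤ (cs.parabolic J).comap (MulAut.conj v⁻¹).toMonoidHom := by
      rw [parabolic, Subgroup.closure_le]
      rintro _ ⟨i, hi, rfl⟩
      simpa using hi.2
    intro u hu
    simpa using this hu
  -- For u ∈ W_K the element uv stays in d W_J, so it is no longer than d w_J = av.
  have haL : cs.IsLongestIn K a := by
    refine ⟨haK, fun u hu => ?_⟩
    have h1 := length_mul_of_minimal_left hvI (parabolic_mono hKI hu)
    have h2 := length_mul_of_minimal_left hvI (parabolic_mono hKI haK)
    have h3 : u * v = d * (b⁻¹ * (v⁻¹ * u * v)) := by rw [hvd]; group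
    have hmem := mul_mem (inv_mem hb) (hconj u hu)
    have h4 := length_mul_of_minimal_right hdJ hmem
    rw [← h3] at h4
    have h5 := hwJ.2 _ hmem
    rw [← hvc, ← hy] at h2
    omega
  refine ⟨K, hKI, v, d, hmv, hvI, hdI, hdJ, ?_, hq.mul_mem_right hdq hwJ.1⟩
  rw [(cs.longest_spec (hI.subset hKI)).unique haL, hy, hvc]

/-- One set arises from the other by adding or by removing one element. -/
def AddOrRemove (C D : Set B) : Prop :=
  ∃ s : B, (s ∉ C ∧ D = C ∪ {s}) ∨ (s ∈ C ∧ D = C \ {s})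

/-- `[I] ++ l` is a reduced expression, with last set `J`, for the double coset with maximal
element `m`. -/
structure IsReducedList (cs : CoxeterSystem M W) (I J : Set B) (m : W) (l : List (Set B)) :
    Prop where
  chain : List.IsChain AddOrRemove (I :: l)
  finitary : ∀ C ∈ I :: l, cs.IsFinitary C
  last : (I :: l).getLast (List.cons_ne_nil _ _) = J
  ideal : ((I :: l).map fun C => (cs.parabolic C : Set W)).prod = cs.bruhatIic m
  prod : ((peaksAux I I l).map (fun KI => cs.longest KI.1 * (cs.longest KI.2)⁻¹) ++
    [cs.longest J]).prod = m
  length : (((peaksAux I I l).map (fun KI => cs.longest KI.1 * (cs.longest KI.2)⁻¹) ++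
    [cs.longest J]).map cs.length).sum = cs.length m

theorem parabolic_mul_parabolic_of_subset {I K : Set B} (h : K ⊆ I) :
    (cs.parabolic I : Set W) * cs.parabolic K = cs.parabolic I := by
  ext x
  constructor
  · rintro ⟨a, ha, b, hb, rfl⟩
    exact mul_mem (S := Subgroup W) ha (parabolic_mono h hb)
  · intro hx
    exact ⟨x, hx, 1, one_mem (cs.parabolic K), mul_one x⟩

/-- Removing the elements of I \ K one at a time changes neither the product of parabolics, as W_I
absorbs W_K, nor the current peak. -/
theorem exists_descending_prefix (cs : CoxeterSystem M W) {I K : Set B} (hI : cs.IsFinitary I)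
    (hK : K ⊆ I) {T : List (Set B)} (hT : List.IsChain AddOrRemove (K :: T))
    (hfin : ∀ C ∈ K :: T, cs.IsFinitary C) :
    ∃ l, List.IsChain AddOrRemove (I :: l) ∧ (∀ C ∈ I :: l, cs.IsFinitary C) ∧
      (I :: l).getLast (List.cons_ne_nil _ _) = (K :: T).getLast (List.cons_ne_nil _ _) ∧
      ((I :: l).map fun C => (cs.parabolic C : Set W)).prod =
        cs.parabolic I * (T.map fun C => (cs.parabolic C : Set W)).prod ∧
      ∀ P, peaksAux P I l = peaksAux P K T := by
  generalize hn : (I \ K).ncard = n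
  induction n generalizing I with
  | zero =>
    rw [Set.ncard_eq_zero (hI.finite.subset Set.sdiff_subset), Set.sdiff_eq_empty] at hn
    obtain rfl := hn.antisymm hK
    exact ⟨T, hT, hfin, rfl, by simp, fun _ => rfl⟩
  | succ n ih =>
    obtain ⟨s, hsI, hsK⟩ : (I \ K).Nonempty := Set.nonempty_of_ncard_ne_zero (by omega)
    have hsub : I \ {s} ⊆ I := Set.sdiff_subset
    obtain ⟨l, h1, h2, h3, h4, h5⟩ := ih (I := I \ {s}) (hI.subset hsub)
      (fun x hx => ⟨hK hx, by rintro rfl; exact hsK hx⟩) (by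
        have e : (I \ {s}) \ K = (I \ K) \ {s} := by
          ext x; simp only [Set.mem_sdiff, Set.mem_singleton_iff]; tauto
        have hs : s ∈ I \ K := ⟨hsI, hsK⟩
        rw [e, Set.ncard_sdiff_singleton_of_mem hs, hn, Nat.add_sub_cancel])
    refine ⟨(I \ {s}) :: l, ?_, ?_, ?_, ?_, fun P => ?_⟩
    · exact List.isChain_cons_cons.2 ⟨⟨s, Or.inr ⟨hsI, rfl⟩⟩, h1⟩
    · exact List.forall_mem_cons.2 ⟨hI, h2⟩
    · rw [List.getLast_cons (List.cons_ne_nil _ _), h3]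
    · rw [List.map_cons, List.prod_cons, h4, ← mul_assoc, parabolic_mul_parabolic_of_subset hsub]
    · rw [peaksAux, if_pos hsub, h5]

theorem IsLongestIn.length_mul_inv {I : Set B} {w u : W} (h : cs.IsLongestIn I w)
    (hu : u ∈ cs.parabolic I) : cs.length (w * u⁻¹) + cs.length u = cs.length w := by
  simpa using h.length_mul (inv_mem hu)

/-- Induction on ℓ(m) − ℓ(w_I) = ℓ(v). Passing to y and L = K ∪ {s} lowers it, because ℓ(y) − ℓ(w_K)
= ℓ(v) and w_L is longer than w_K. -/
theorem exists_isReducedList {I J : Set B} (hI : cs.IsFinitary I) (hJ : cs.IsFinitary J)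
    {q : Set W} (hq : cs.IsCoset I J q) {m : W} (hm : cs.IsMaxIn q m) :
    ∃ l, cs.IsReducedList I J m l := by
  obtain ⟨n, hn⟩ : ∃ n, cs.length m ≤ n + cs.length (cs.longest I) := ⟨_, Nat.le_add_right _ _⟩
  induction n using Nat.strong_induction_on generalizing I q m with
  | _ n ih =>
  obtain ⟨K, hKI, v, d, hmv, hvI, hdI, hdJ, hy, hyq⟩ := hm.exists_decomposition hI hJ hq
  have hKfin := hI.subset hKI
  have hwI := cs.longest_spec hI
  have hwJ := cs.longest_spec hJ
  have hwK := cs.longest_spec hKfin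
  have hyJ := hJ.rightDescent_mul_longest hdJ
  have hyd := hJ.length_mul_longest hdJ
  set y := d * cs.longest J with hydef
  have hyl : cs.length y = cs.length (cs.longest K) + cs.length v := by
    rw [← hy]; exact length_mul_of_minimal_left hvI (parabolic_mono hKI hwK.1)
  have hml : cs.length m = cs.length (cs.longest I) + cs.length v := by
    rw [hmv]; exact length_mul_of_minimal_left hvI hwI.1
  have hmy : m = cs.longest I * (cs.longest K)⁻¹ * y := by rw [hmv, ← hy]; group
  have hIK := hwI.length_mul_inv (parabolic_mono hKI hwK.1)
  by_cases hs : ∃ s, s ∉ K ∧ cs.length (cs.simple s * y) < cs.length y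
  · obtain ⟨s, hsK, hsy⟩ := hs
    set L := K ∪ {s} with hL
    have hKL : K ⊆ L := Set.subset_union_left
    have hyL : ∀ i ∈ L, cs.length (cs.simple i * y) < cs.length y := by
      rintro i (hi | rfl)
      · have h1 := hwK.length_mul_left (simple_mem_parabolic hi)
        have h2 := length_mul_of_minimal_left hvI (parabolic_mono hKI
          (mul_mem (simple_mem_parabolic hi) hwK.1))
        rw [length_simple] at h1
        rw [mul_assoc, hy] at h2
        omega
      · exact hsy
    have hLfin := isFinitary_of_leftDescents hyL
    have hwL := cs.longest_spec hLfin
    have hKltL : cs.length (cs.longest K) < cs.length (cs.longest L) := by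
      have hsL : cs.simple s ∈ cs.parabolic L := simple_mem_parabolic (Or.inr rfl)
      rcases cs.bruhatLE_mul_simple_total (cs.longest K) s with h | h
      · exact h.1.trans_le (hwL.2 _ (mul_mem (parabolic_mono hKL hwK.1) hsL))
      · have h1 := mul_mem (inv_mem hwK.1) (h.2.mem_parabolic hwK.1)
        rw [inv_mul_cancel_left] at h1
        exact absurd (mem_of_simple_mem_parabolic h1) hsK
    have hLy := ((cs.one_bruhatLE y).parabolic_mul_le hyL hwL.1).length_le
    rw [mul_one] at hLy
    have hq' : cs.IsCoset L J (DoubleCoset.doubleCoset y (cs.parabolic L) (cs.parabolic J)) :=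
      ⟨y, rfl⟩
    have hmax := hq'.isMaxIn (DoubleCoset.mem_doubleCoset_self _ _ _) hyL hyJ
    obtain ⟨l', hl'⟩ := ih (n - 1) (by omega) hLfin hq' hmax (by omega)
    obtain ⟨l, h1, h2, h3, h4, h5⟩ := exists_descending_prefix cs hI hKI (T := L :: l')
      (List.isChain_cons_cons.2 ⟨⟨s, Or.inl ⟨hsK, rfl⟩⟩, hl'.chain⟩)
      (List.forall_mem_cons.2 ⟨hKfin, hl'.finitary⟩)
    have hLK : ¬ L ⊆ K := fun h => hsK (h (Or.inr rfl))
    refine ⟨l, h1, h2, ?_, ?_, ?_, ?_⟩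
    · rw [h3, List.getLast_cons (List.cons_ne_nil _ _), hl'.last]
    · rw [h4, hl'.ideal, ← hI.bruhatIic_longest, ← bruhatIic_star]
      congr 1
      -- The Demazure product of w_I and y is m: m dominates W_I times the ideal of y because y ∈ q,
      -- and conversely m = (w_I w_K⁻¹) y.
      apply BruhatLE.antisymm
      · rw [← mem_bruhatIic]
        have : cs.star (cs.longest I) y ∈ cs.bruhatIic (cs.star (cs.longest I) y) := .refl _
        rw [bruhatIic_star, hI.bruhatIic_longest] at this
        obtain ⟨a, ha, b, hb, hab⟩ := this
        rw [← hab]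
        exact BruhatLE.parabolic_mul_le (hm.leftDescent hq)
          (BruhatLE.trans (y := y) hb (hm.2 _ hyq)) ha
      · rw [← mem_bruhatIic, bruhatIic_star, hI.bruhatIic_longest, hmy]
        exact Set.mul_mem_mul (mul_mem (S := Subgroup W) hwI.1
          (inv_mem (parabolic_mono hKI hwK.1))) (.refl _)
    · rw [h5, peaksAux, if_neg hLK]
      -- If K = I there is no descent, so I is not a local maximum and the missing factor w_I w_K⁻¹
      -- is 1.
      split_ifs with hIKeq
      · rw [hl'.prod, hmy, hIKeq, mul_inv_cancel, one_mul]
      · rw [List.map_cons, List.cons_append, List.prod_cons, hl'.prod, hmy]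
    · rw [h5, peaksAux, if_neg hLK]
      split_ifs with hIKeq
      · rw [hl'.length, hmy, hIKeq, mul_inv_cancel, one_mul]
      · rw [List.map_cons, List.cons_append, List.map_cons, List.sum_cons, hl'.length]
        dsimp only
        omega
  · push Not at hs
    -- A left descent of d would be one of y = d w_J, hence lie in K ⊆ I, where d has only ascents.
    have hd1 : d = 1 := by
      by_contra hne
      obtain ⟨s, hsd⟩ := cs.exists_leftDescent_of_ne_one hne
      have h1 := cs.length_mul_le (cs.simple s * d) (cs.longest J)
      rw [mul_assoc, ← hydef] at h1
      have h2 : cs.length (cs.simple s * d) < cs.length d := hsd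
      have hsK : s ∈ K := by
        by_contra hsK
        have := hs s hsK
        omega
      have := hdI s (hKI hsK)
      omega
    have hyw : y = cs.longest J := by rw [hydef, hd1, one_mul]
    have hJI : J ⊆ I := by
      intro j hj
      by_contra hjI
      have h1 := hs j (fun h => hjI (hKI h))
      have h2 := hwJ.length_mul_left (simple_mem_parabolic hj)
      rw [length_simple] at h2
      rw [hyw] at h1
      omega
    have hmw : m = cs.longest I := by
      have hmI : m ∈ cs.parabolic I := by
        rw [hmy, hyw]
        exact mul_mem (mul_mem hwI.1 (inv_mem (parabolic_mono hKI hwK.1)))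
          (parabolic_mono hJI hwJ.1)
      have := hwI.2 m hmI
      have hv1 : v = 1 := by rw [← cs.length_eq_zero_iff]; omega
      rw [hmv, hv1, mul_one]
    obtain ⟨l, h1, h2, h3, h4, h5⟩ := exists_descending_prefix cs hI hJI (T := [])
      (List.isChain_singleton _) (by simpa using hJ)
    have hIJ := hwI.length_mul_inv (parabolic_mono hJI hwJ.1)
    refine ⟨l, h1, h2, by simpa using h3, ?_, ?_, ?_⟩
    · rw [h4, hmw, hI.bruhatIic_longest]; simp
    · rw [h5, peaksAux, hmw]; simp
    · rw [h5, peaksAux, hmw]; simpa using hIJ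

theorem IsReducedList.exists_reducedExpresses {I J : Set B} {q : Set W} {l : List (Set B)}
    (hq : cs.IsCoset I J q) (h : cs.IsReducedList I J (cs.maxRep q) l) :
    ∃ E : cs.SinglestepExpr, E.ReducedExpresses I J q := by
  let E : cs.SinglestepExpr :=
    { width := l.length
      set := fun k => (I :: l).get k
      finitary := fun k => h.finitary _ (List.get_mem _ _)
      step := fun k => by
        have := List.isChain_iff_getElem.1 h.chain k (by simp)
        exact this }
  have hfirst : E.first = I := rfl
  have hlast : E.last = J := by
    rw [← h.last, List.getLast_eq_getElem]
    rfl
  have hmulti : E.multistep = peaksAux I I l := by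
    have : (List.ofFn fun k : Fin E.width => E.set k.succ) = l := List.ofFn_get l
    rw [SinglestepExpr.multistep, this, hfirst]
  have hfactors : E.factors = (peaksAux I I l).map
      (fun KI => cs.longest KI.1 * (cs.longest KI.2)⁻¹) ++ [cs.longest J] := by
    rw [SinglestepExpr.factors, hmulti, hlast]
  refine ⟨E, ⟨hfirst, hlast, hq, ?_⟩, ?_, ?_⟩
  · apply cs.bruhatIic_injective
    rw [E.bruhatIic_foldl, ← h.ideal]
    congr 1
    have e : (I :: l).map (fun C => (cs.parabolic C : Set W)) =
        (List.ofFn (I :: l).get).map (fun C => (cs.parabolic C : Set W)) := by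
      rw [List.ofFn_get]
    rw [e, List.map_ofFn]
    rfl
  · rw [hfactors, h.prod]
  · rw [hfactors, h.length, h.prod]

theorem IsCoset.exists_reducedExpresses {I J : Set B} (hI : cs.IsFinitary I)
    (hJ : cs.IsFinitary J) {q : Set W} (hq : cs.IsCoset I J q) :
    ∃ E : cs.SinglestepExpr, E.ReducedExpresses I J q :=
  let ⟨_, hl⟩ := exists_isReducedList hI hJ hq (hq.isMaxIn_maxRep hI hJ)
  hl.exists_reducedExpresses hq

end ReducedExpressions

end CoxeterSystem

theorem theorem2 {B : Type*} {M : CoxeterMatrix B} {W : Type*} [Group W]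
    (cs : CoxeterSystem M W) (I J : Set B) (hI : cs.IsFinitary I) (hJ : cs.IsFinitary J)
    (p q : Set W) (hp : cs.IsCoset I J p) (hq : cs.IsCoset I J q) :
    (∀ r, cs.IsCoset I J r → cs.IsMaxIn r (cs.maxRep r) ∧ cs.IsMinIn r (cs.minRep r)) ∧
    List.TFAE [
      cs.BruhatLE (cs.maxRep p) (cs.maxRep q),
      cs.BruhatLE (cs.minRep p) (cs.minRep q),
      ∃ E : cs.SinglestepExpr, E.ReducedExpresses I J q ∧ E.IsTerminus p,
      ∀ E : cs.SinglestepExpr, E.Expresses I J q → E.IsTerminus p] := by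
  have hmax := fun r (hr : cs.IsCoset I J r) => hr.isMaxIn_maxRep hI hJ
  have hmin := fun r (hr : cs.IsCoset I J r) => hr.isMinIn_minRep
  refine ⟨fun r hr => ⟨hmax r hr, hmin r hr⟩, ?_⟩
  tfae_have 1 ↔ 2 :=
    CoxeterSystem.bruhatLE_max_iff_min hp hq (hmax p hp) (hmax q hq) (hmin p hp) (hmin q hq)
  tfae_have 1 → 4 := fun h E hE => (hE.isTerminus_iff hI hJ hp).2 h
  tfae_have 4 → 3 := fun h =>
    let ⟨E, hE⟩ := hq.exists_reducedExpresses hI hJ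
    ⟨E, hE, h E hE.1⟩
  tfae_have 3 → 1 := fun ⟨_, hE, h⟩ => (hE.1.isTerminus_iff hI hJ hp).1 h
  tfae_finish
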